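/- Let $\tau\in\mathbb C$ with $\operatorname{Im}\tau>0$, $\Gamma_\tau=\mathbb Z\tau+\mathbb Z$, $E_\tau=\mathbb C/\Gamma_\tau$ and $q=e^{2\pi i\tau}$. Let $A:\mathbb C^*\to GL_n(\mathbb C)$ be holomorphic. Let $A(m,u)$, for $m\in\mathbb Z$ and $u\in\mathbb C^*$, be determined by $A(0,u)=I_n$ and $A(m+1,u)=A(q^mu)A(m,u)$, so that $A(m,u)=A(q^{m-1}u)\cdots A(qu)A(u)$ for $m>0$. The holomorphic vector bundle $E_\tau(A)$ of rank $n$ on $E_\tau$ is the quotient of $\mathbb C\times\mathbb C^n$ by the action $(m\tau+k)\cdot(z,v)=(z+m\tau+k,\;A(m,e^{2\pi i z})v)$ of $\Gamma_\tau$, and a holomorphic vector bundle on $E_\tau$ is said to be defined by $A$ if it is isomorphic to $E_\tau(A)$. For an integer $r\ge 1$ let $\pi_r:E_{r\tau}\to E_\tau$, $[z]\mapsto[z]$, be the natural $r$-sheeted covering, where $E_{r\tau}$ and the bundles $E_{r\tau}(\cdot)$ on it are formed in the same way with $r\tau$ and $q^r$ in place of $\tau$ and $q$. A holomorphic vector bundle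 $G$ on $E_\tau$ is the direct image $\pi_{r*}F$ of a holomorphic vector bundle $F$ on $E_{r\tau}$ if its sheaf of holomorphic sections is isomorphic, as an $\mathcal O_{E_\tau}$-module, to the direct image of the sheaf of holomorphic sections of $F$. (1) Let $\tilde A:\mathbb C^*\to GL_n(\mathbb C)$ be holomorphic and let $F$ be a holomorphic vector bundle on $E_{r\tau}$ defined by $\tilde A$. Then $\pi_{r*}F$ is defined by the $rn\times rn$ block matrix $$\begin{pmatrix}0&I_{(r-1)n}\\ \tilde A(u)&0\end{pmatrix},$$ that is, the bundle on $E_\tau$ defined by this matrix function is a direct image of $F$, and every holomorphic vector bundle on $E_\tau$ which is a direct image of $F$ is isomorphic to it. (2) Let $A:\mathbb C^*\to GL_n(\mathbb C)$ be holomorphic. Then $\pi_r^*\pi_{r*}E_{r\tau}(A)$ is defined by the block-diagonal matrix $\operatorname{diag}(A(q^{r-1}u),\dots,A(qu),A(u))$; in other words, $$\pi_r^*\pi_{r*}E_{r\tau}(A)\;\cong\;\bigoplus_{i=0}^{r-1}E_{r\tau}\big(A(q^iu)\big),$$ with $q=e^{2\pi i\tau}$. -/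

import Mathlib

namespace EllVB

open scoped UpperHalfPlane Manifold ContDiff Topology Bundle
open Bundle Set TopologicalSpace

noncomputable section

/-! ### One-dimensional complex tori -/

/-- The lattice `Γ_τ = ℤτ + ℤ`. -/
def lattice (τ : ℍ) : AddSubgroup ℂ where
  carrier := {z | ∃ m n : ℤ, z = m * (τ : ℂ) + n}
  zero_mem' := ⟨0, 0, by simp⟩
  add_mem' := by
    rintro _ _ ⟨m, n, rfl⟩ ⟨m', n', rfl⟩
    exact ⟨m + m', n + n', by push_cast; ring⟩
  neg_mem' := by
    rintro _ ⟨m, n, rfl⟩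
    exact ⟨-m, -n, by push_cast; ring⟩

/-- The coefficient `m` of `γ = mτ + n ∈ Γ_τ`. -/
def tauCoeff {τ : ℍ} (γ : lattice τ) : ℤ := γ.2.choose

theorem tauCoeff_eq {τ : ℍ} {γ : lattice τ} {m n : ℤ} (h : (γ : ℂ) = m * (τ : ℂ) + n) :
    tauCoeff γ = m := by
  obtain ⟨n', h'⟩ : ∃ n' : ℤ, (γ : ℂ) = (tauCoeff γ : ℂ) * (τ : ℂ) + n' := γ.2.choose_spec
  have h1 := congrArg Complex.im (h.symm.trans h')
  have hτ : (τ : ℂ).im ≠ 0 := τ.coe_im_pos.ne'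
  simp only [Complex.add_im, Complex.mul_im, Complex.intCast_re, Complex.intCast_im, zero_mul,
    add_zero] at h1
  exact_mod_cast (mul_right_cancel₀ hτ h1).symm

theorem exists_eq_tauCoeff {τ : ℍ} (γ : lattice τ) :
    ∃ n : ℤ, (γ : ℂ) = (tauCoeff γ : ℂ) * (τ : ℂ) + n := γ.2.choose_spec

theorem tauCoeff_add {τ : ℍ} (γ δ : lattice τ) : tauCoeff (γ + δ) = tauCoeff γ + tauCoeff δ := by
  obtain ⟨n, hn⟩ := exists_eq_tauCoeff γ
  obtain ⟨n', hn'⟩ := exists_eq_tauCoeff δ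
  refine tauCoeff_eq (n := n + n') ?_
  rw [AddSubgroup.coe_add, hn, hn']
  push_cast
  ring

theorem eq_zero_of_norm_lt {τ : ℍ} {z : ℂ} (hz : z ∈ lattice τ) (h1 : ‖z‖ < 1)
    (h2 : ‖z‖ < (τ : ℂ).im) : z = 0 := by
  obtain ⟨m, n, rfl⟩ := hz
  have hτ := τ.coe_im_pos
  have hi := (Complex.abs_im_le_norm _).trans_lt h2
  simp only [Complex.add_im, Complex.mul_im, Complex.intCast_re, Complex.intCast_im, zero_mul,
    add_zero, abs_mul, abs_of_pos hτ] at hi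
  have hm : m = 0 := by
    have : |(m : ℝ)| < 1 := by
      by_contra hc
      nlinarith [mul_le_mul_of_nonneg_right (not_lt.mp hc) hτ.le]
    exact Int.abs_lt_one_iff.mp (by exact_mod_cast this)
  subst hm
  have hr := (Complex.abs_re_le_norm _).trans_lt h1
  have hn : n = 0 := by
    have : |(n : ℝ)| < 1 := by simpa using hr
    exact Int.abs_lt_one_iff.mp (by exact_mod_cast this)
  simp [hn]

instance (τ : ℍ) : DiscreteTopology (lattice τ) := by
  rw [discreteTopology_iff_isOpen_singleton_zero, Metric.isOpen_singleton_iff]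
  refine ⟨min 1 (τ : ℂ).im, lt_min one_pos τ.coe_im_pos, fun γ hγ => ?_⟩
  have : ‖(γ : ℂ)‖ < min 1 (τ : ℂ).im := by simpa [dist_eq_norm] using hγ
  exact Subtype.ext (eq_zero_of_norm_lt γ.2 (this.trans_le (min_le_left _ _))
    (this.trans_le (min_le_right _ _)))

/-- The complex torus `E_τ = ℂ / Γ_τ`. -/
def Torus (τ : ℍ) : Type := ℂ ⧸ lattice τ

instance (τ : ℍ) : AddCommGroup (Torus τ) := inferInstanceAs (AddCommGroup (ℂ ⧸ lattice τ))

instance (τ : ℍ) : TopologicalSpace (Torus τ) := inferInstanceAs (TopologicalSpace (ℂ ⧸ lattice τ))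

/-- The projection `p_τ : ℂ → E_τ`. -/
def proj (τ : ℍ) : ℂ →+ Torus τ := QuotientAddGroup.mk' (lattice τ)

theorem proj_surjective (τ : ℍ) : Function.Surjective (proj τ) :=
  QuotientAddGroup.mk'_surjective (lattice τ)

theorem proj_eq_iff {τ : ℍ} {z w : ℂ} : proj τ z = proj τ w ↔ w - z ∈ lattice τ := by
  have : proj τ z = proj τ w ↔ -z + w ∈ lattice τ := QuotientAddGroup.eq
  rw [this, neg_add_eq_sub]

theorem proj_add {τ : ℍ} (γ : lattice τ) (z : ℂ) : proj τ (γ + z) = proj τ z :=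
  (proj_eq_iff.mpr (by simp)).symm

theorem isLocalHomeomorph_proj (τ : ℍ) : IsLocalHomeomorph (proj τ) :=
  (AddSubgroup.isAddQuotientCoveringMap_of_comm (lattice τ)
    (SetLike.isDiscrete_iff_discreteTopology.mpr inferInstance)).isCoveringMap.isLocalHomeomorph

/-- The local inverse of `p_τ : ℂ → E_τ` around `z`. -/
def localInv (τ : ℍ) (z : ℂ) : OpenPartialHomeomorph (Torus τ) ℂ :=
  (isLocalHomeomorph_proj τ).localInverseAt z

theorem proj_localInv {τ : ℍ} {z : ℂ} {x : Torus τ} (hx : x ∈ (localInv τ z).source) :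
    proj τ (localInv τ z x) = x :=
  (isLocalHomeomorph_proj τ).apply_localInverseAt_of_mem hx

theorem localInv_symm (τ : ℍ) (z : ℂ) : ((localInv τ z).symm : ℂ → Torus τ) = proj τ :=
  (isLocalHomeomorph_proj τ).localInverseAt_symm z

theorem mem_localInv_source (τ : ℍ) (z : ℂ) : proj τ z ∈ (localInv τ z).source :=
  (isLocalHomeomorph_proj τ).apply_self_mem_localInverseAt_source

/-- A chosen preimage of a point of the torus. -/
def lift {τ : ℍ} (x : Torus τ) : ℂ := (proj_surjective τ x).choose

theorem proj_lift {τ : ℍ} (x : Torus τ) : proj τ (lift x) = x := (proj_surjective τ x).choose_spec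

theorem mem_localInv_lift_source {τ : ℍ} (x : Torus τ) : x ∈ (localInv τ (lift x)).source := by
  simpa [proj_lift] using mem_localInv_source τ (lift x)

/-- The complex structure of `E_τ`: the charts are the local inverses of `p_τ`. -/
instance (τ : ℍ) : ChartedSpace ℂ (Torus τ) where
  atlas := range (localInv τ)
  chartAt x := localInv τ (lift x)
  mem_chart_source := mem_localInv_lift_source
  chart_mem_atlas _ := mem_range_self _

/-- Two local inverses of `p_τ` differ, near a given point, by a constant lattice vector. -/
theorem localInv_sub_eventuallyEq {τ : ℍ} {a b : ℂ} {x : Torus τ} (ha : x ∈ (localInv τ a).source)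
    (hb : x ∈ (localInv τ b).source) :
    ∃ γ : lattice τ, ∀ᶠ y in 𝓝 x, localInv τ b y = γ + localInv τ a y := by
  set f : Torus τ → ℂ := fun y => localInv τ b y - localInv τ a y
  have hmem : ∀ y ∈ (localInv τ a).source ∩ (localInv τ b).source, f y ∈ lattice τ :=
    fun y hy => proj_eq_iff.mp ((proj_localInv hy.1).trans (proj_localInv hy.2).symm)
  have hf : ContinuousAt f x :=
    ((localInv τ b).continuousAt hb).sub ((localInv τ a).continuousAt ha)
  have hx := hmem x ⟨ha, hb⟩
  refine ⟨⟨f x, hx⟩, ?_⟩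
  have hε : 0 < min 1 (τ : ℂ).im := lt_min one_pos τ.coe_im_pos
  filter_upwards [hf (Metric.ball_mem_nhds (f x) hε),
    ((localInv τ a).open_source.inter (localInv τ b).open_source).mem_nhds ⟨ha, hb⟩] with y hy hys
  have h0 : f y - f x = 0 := by
    have hd : ‖f y - f x‖ < min 1 (τ : ℂ).im := by
      simpa [dist_eq_norm] using hy
    exact eq_zero_of_norm_lt (sub_mem (hmem y hys) hx) (hd.trans_le (min_le_left _ _))
      (hd.trans_le (min_le_right _ _))
  change localInv τ b y = f x + localInv τ a y
  rw [← sub_eq_zero.mp h0]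
  simp [f]

instance (τ : ℍ) : IsManifold 𝓘(ℂ, ℂ) ω (Torus τ) := by
  apply isManifold_of_contDiffOn
  rintro _ _ ⟨a, rfl⟩ ⟨b, rfl⟩ z hz
  simp only [modelWithCornersSelf_coe, modelWithCornersSelf_coe_symm, preimage_id_eq, id_eq,
    range_id, inter_univ, Function.comp_id, Function.id_comp] at hz ⊢
  have hz' : z ∈ (localInv τ a).target ∧ (localInv τ a).symm z ∈ (localInv τ b).source := by
    simpa using hz
  obtain ⟨γ, hγ⟩ := localInv_sub_eventuallyEq ((localInv τ a).map_target hz'.1) hz'.2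
  have h1 := ((localInv τ a).continuousAt_symm hz'.1).eventually hγ
  refine ContDiffAt.contDiffWithinAt ?_
  refine (contDiffAt_const.add contDiffAt_id : ContDiffAt ℂ ω (fun w => (γ : ℂ) + id w) z).congr_of_eventuallyEq ?_
  filter_upwards [h1, (localInv τ a).open_target.mem_nhds hz'.1] with w hw hwt
  simp [hw, (localInv τ a).right_inv hwt]

/-- `p_τ : ℂ → E_τ` is holomorphic. -/
theorem contMDiff_proj (τ : ℍ) : ContMDiff 𝓘(ℂ, ℂ) 𝓘(ℂ, ℂ) ω (proj τ) := by
  intro z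
  have hc := (isLocalHomeomorph_proj τ).continuous.continuousAt (x := z)
  rw [contMDiffAt_iff_target]
  refine ⟨hc, ?_⟩
  obtain ⟨γ, hγ⟩ := localInv_sub_eventuallyEq (mem_localInv_source τ z)
    (mem_localInv_lift_source (proj τ z))
  have h2 : (localInv τ z).target ∈ 𝓝 z :=
    (localInv τ z).open_target.mem_nhds (isLocalHomeomorph_proj τ).self_mem_localInverseAt_target
  rw [contMDiffAt_iff_contDiffAt]
  refine (contDiffAt_const.add contDiffAt_id : ContDiffAt ℂ ω (fun w => (γ : ℂ) + id w) z).congr_of_eventuallyEq ?_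
  filter_upwards [hc.eventually hγ, h2] with w hw hwt
  have h3 : localInv τ z (proj τ w) = w := by
    have := (localInv τ z).right_inv hwt
    rwa [localInv_symm] at this
  simp only [extChartAt, OpenPartialHomeomorph.extend, chartAt, mfld_simps]
  change localInv τ (lift (proj τ z)) (proj τ w) = γ + w
  rw [hw, h3]

/-- The local inverses of `p_τ` are holomorphic. -/
theorem contMDiffOn_localInv (τ : ℍ) (z : ℂ) :
    ContMDiffOn 𝓘(ℂ, ℂ) 𝓘(ℂ, ℂ) ω (localInv τ z) (localInv τ z).source :=
  contMDiffOn_of_mem_maximalAtlas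
    (IsManifold.subset_maximalAtlas (mem_range_self z : localInv τ z ∈ atlas ℂ (Torus τ)))

/-- The point `rτ` of the upper half plane. -/
def scale (r : ℕ) [NeZero r] (τ : ℍ) : ℍ :=
  ⟨r * (τ : ℂ), by
    simpa using mul_pos (Nat.cast_pos.mpr (Nat.pos_of_ne_zero (NeZero.ne r))) τ.coe_im_pos⟩

theorem lattice_scale_le (r : ℕ) [NeZero r] (τ : ℍ) : lattice (scale r τ) ≤ lattice τ := by
  rintro _ ⟨m, n, rfl⟩
  exact ⟨m * r, n, by simp [scale, mul_assoc]⟩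

/-- The covering `π_r : E_{rτ} → E_τ`, `[z] ↦ [z]`, as a map. -/
def coverFun (r : ℕ) [NeZero r] (τ : ℍ) : Torus (scale r τ) →+ Torus τ :=
  QuotientAddGroup.map (lattice (scale r τ)) (lattice τ) (AddMonoidHom.id ℂ)
    (lattice_scale_le r τ)

theorem coverFun_proj (r : ℕ) [NeZero r] (τ : ℍ) (z : ℂ) :
    coverFun r τ (proj (scale r τ) z) = proj τ z := rfl

/-- The `r`-sheeted covering `π_r : E_{rτ} → E_τ`, `[z] ↦ [z]`, as a holomorphic map. -/
def cover (r : ℕ) [NeZero r] (τ : ℍ) :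
    C^ω⟮𝓘(ℂ, ℂ), Torus (scale r τ); 𝓘(ℂ, ℂ), Torus τ⟯ where
  val := coverFun r τ
  property := by
    intro x
    have hx := mem_localInv_lift_source x
    refine (((contMDiff_proj τ).contMDiffAt (x := localInv (scale r τ) (lift x) x)).comp x
      ((contMDiffOn_localInv (scale r τ) (lift x)).contMDiffAt
        ((localInv _ _).open_source.mem_nhds hx))).congr_of_eventuallyEq ?_
    filter_upwards [(localInv _ _).open_source.mem_nhds hx] with y hy
    conv_lhs => rw [← proj_localInv hy]
    rfl

/-! ### Holomorphic vector bundles -/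

/-- A holomorphic vector bundle (of finite rank) on a Riemann surface `X`. Over `ℂ`, the smoothness
exponent `ω` means complex-analytic, that is, holomorphic. -/
structure HolVectorBundle (X : Type) [TopologicalSpace X] [ChartedSpace ℂ X] where
  /-- the model fibre, `ℂⁿ` up to isomorphism -/
  Model : Type
  [normedAddCommGroupModel : NormedAddCommGroup Model]
  [normedSpaceModel : NormedSpace ℂ Model]
  [finiteDimensionalModel : FiniteDimensional ℂ Model]
  /-- the fibres -/
  Fiber : X → Type
  [addCommMonoidFiber : ∀ x, AddCommMonoid (Fiber x)]
  [moduleFiber : ∀ x, Module ℂ (Fiber x)]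
  [topologicalSpaceFiber : ∀ x, TopologicalSpace (Fiber x)]
  [topologicalSpaceTotal : TopologicalSpace (TotalSpace Model Fiber)]
  [fiberBundle : FiberBundle Model Fiber]
  [vectorBundle : VectorBundle ℂ Model Fiber]
  [holomorphic : ContMDiffVectorBundle ω Model Fiber 𝓘(ℂ, ℂ)]

namespace HolVectorBundle

attribute [instance] normedAddCommGroupModel normedSpaceModel finiteDimensionalModel
  addCommMonoidFiber moduleFiber topologicalSpaceFiber topologicalSpaceTotal fiberBundle
  vectorBundle holomorphic

variable {X : Type} [TopologicalSpace X] [ChartedSpace ℂ X]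
variable {Y : Type} [TopologicalSpace Y] [ChartedSpace ℂ Y]

/-- An isomorphism of holomorphic vector bundles: fibrewise linear bijections which are
holomorphic, with holomorphic inverse, as maps between the total spaces. -/
structure Iso (E F : HolVectorBundle X) where
  toEquiv : ∀ x, E.Fiber x ≃ₗ[ℂ] F.Fiber x
  contMDiff_toEquiv : ContMDiff (𝓘(ℂ, ℂ).prod 𝓘(ℂ, E.Model)) (𝓘(ℂ, ℂ).prod 𝓘(ℂ, F.Model)) ω
    (fun p : TotalSpace E.Model E.Fiber => TotalSpace.mk' F.Model p.1 (toEquiv p.1 p.2))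
  contMDiff_symm : ContMDiff (𝓘(ℂ, ℂ).prod 𝓘(ℂ, F.Model)) (𝓘(ℂ, ℂ).prod 𝓘(ℂ, E.Model)) ω
    (fun p : TotalSpace F.Model F.Fiber => TotalSpace.mk' E.Model p.1 ((toEquiv p.1).symm p.2))

/-- Two holomorphic vector bundles are isomorphic. -/
def IsIsomorphic (E F : HolVectorBundle X) : Prop := Nonempty (Iso E F)

/-- The pullback `φ^*E` of a holomorphic vector bundle along a holomorphic map. -/
def pullback (φ : C^ω⟮𝓘(ℂ, ℂ), Y; 𝓘(ℂ, ℂ), X⟯) (E : HolVectorBundle X) : HolVectorBundle Y where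
  Model := E.Model
  Fiber := (φ : Y → X) *ᵖ E.Fiber

section DirectSum

variable {ι : Type} [Fintype ι] (E : ι → HolVectorBundle X)

/-- The trivialization of a direct sum given by trivializations of the summands. -/
def sumPretrivialization (e : ∀ i, Trivialization (E i).Model (π (E i).Model (E i).Fiber)) :
    Pretrivialization (∀ i, (E i).Model)
      (π (∀ i, (E i).Model) (fun x => ∀ i, (E i).Fiber x)) where
  toFun p := (p.1, fun i => (e i ⟨p.1, p.2 i⟩).2)
  invFun p := ⟨p.1, fun i => (e i).symm p.1 (p.2 i)⟩
  baseSet := ⋂ i, (e i).baseSet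
  source := {p | p.1 ∈ ⋂ i, (e i).baseSet}
  target := (⋂ i, (e i).baseSet) ×ˢ univ
  map_source' p hp := ⟨hp, mem_univ _⟩
  map_target' p hp := hp.1
  left_inv' := by
    rintro ⟨x, v⟩ hx
    have hx' : ∀ i, x ∈ (e i).baseSet := by simpa using hx
    simp only [TotalSpace.mk.injEq, heq_eq_eq, true_and]
    funext i
    exact (e i).symm_apply_apply_mk (hx' i) (v i)
  right_inv' := by
    rintro ⟨x, v⟩ ⟨hx, -⟩
    have hx' : ∀ i, x ∈ (e i).baseSet := by simpa using hx
    simp only [Prod.mk.injEq, true_and]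
    funext i
    rw [(e i).apply_mk_symm (hx' i)]
  open_target := (isOpen_iInter_of_finite fun i => (e i).open_baseSet).prod isOpen_univ
  open_baseSet := isOpen_iInter_of_finite fun i => (e i).open_baseSet
  source_eq := rfl
  target_eq := rfl
  proj_toFun _ _ := rfl

/-- The block-diagonal change of coordinates of a direct sum. -/
def sumCoordChange (e e' : ∀ i, Trivialization (E i).Model (π (E i).Model (E i).Fiber))
    [∀ i, MemTrivializationAtlas (e i)] [∀ i, MemTrivializationAtlas (e' i)] (x : X) :
    (∀ i, (E i).Model) →L[ℂ] (∀ i, (E i).Model) := by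
  classical
  exact ∑ i, (ContinuousLinearMap.single ℂ (fun i => (E i).Model) i).comp
    (((e i).coordChangeL ℂ (e' i) x : (E i).Model →L[ℂ] (E i).Model).comp
      (ContinuousLinearMap.proj i))

theorem contMDiffOn_sumCoordChange
    (e e' : ∀ i, Trivialization (E i).Model (π (E i).Model (E i).Fiber))
    [∀ i, MemTrivializationAtlas (e i)] [∀ i, MemTrivializationAtlas (e' i)] :
    ContMDiffOn 𝓘(ℂ, ℂ) 𝓘(ℂ, (∀ i, (E i).Model) →L[ℂ] (∀ i, (E i).Model)) ω
      (sumCoordChange E e e') ((⋂ i, (e i).baseSet) ∩ ⋂ i, (e' i).baseSet) := by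
  classical
  unfold sumCoordChange
  refine contMDiffOn_finsetSum fun i _ => ?_
  refine contMDiffOn_const.clm_comp (ContMDiffOn.clm_comp ?_ contMDiffOn_const)
  refine (contMDiffOn_coordChangeL (e i) (e' i)).mono ?_
  rintro x ⟨hx, hx'⟩
  exact ⟨mem_iInter.mp hx i, mem_iInter.mp hx' i⟩

theorem sumCoordChange_apply
    (e e' : ∀ i, Trivialization (E i).Model (π (E i).Model (E i).Fiber))
    [∀ i, MemTrivializationAtlas (e i)] [∀ i, MemTrivializationAtlas (e' i)] {x : X}
    (hx : x ∈ (⋂ i, (e i).baseSet) ∩ ⋂ i, (e' i).baseSet) (v : ∀ i, (E i).Model) :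
    sumCoordChange E e e' x v =
      (sumPretrivialization E e' ⟨x, (sumPretrivialization E e).symm x v⟩).2 := by
  classical
  have h : (sumPretrivialization E e).symm x v = fun i => (e i).symm x (v i) := by
    rw [Pretrivialization.symm_apply _ hx.1]
    rfl
  rw [h]
  funext i
  have hi : x ∈ (e i).baseSet ∩ (e' i).baseSet := ⟨mem_iInter.mp hx.1 i, mem_iInter.mp hx.2 i⟩
  change sumCoordChange E e e' x v i = (e' i ⟨x, (e i).symm x (v i)⟩).2
  rw [← (e i).coordChangeL_apply (R := ℂ) (e' i) hi]
  simp [sumCoordChange, Finset.sum_apply]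

/-- The vector prebundle of a direct sum. -/
def sumPrebundle : VectorPrebundle ℂ (∀ i, (E i).Model) (fun x => ∀ i, (E i).Fiber x) where
  pretrivializationAtlas := {e | ∃ (e₀ : ∀ i, Trivialization (E i).Model
    (π (E i).Model (E i).Fiber)) (_ : ∀ i, MemTrivializationAtlas (e₀ i)),
    e = sumPretrivialization E e₀}
  pretrivialization_linear' := by
    rintro _ ⟨e, he, rfl⟩
    refine ⟨fun x hx => ⟨fun v w => ?_, fun c v => ?_⟩⟩ <;> funext i <;>
      have hi := mem_iInter.mp hx i
    · exact ((e i).linear ℂ hi).map_add (v i) (w i)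
    · exact ((e i).linear ℂ hi).map_smul c (v i)
  pretrivializationAt x := sumPretrivialization E
    (fun i => trivializationAt (E i).Model (E i).Fiber x)
  mem_base_pretrivializationAt x := mem_iInter.mpr fun i => mem_baseSet_trivializationAt _ _ x
  pretrivialization_mem_atlas x := ⟨_, fun i => inferInstance, rfl⟩
  exists_coordChange := by
    rintro _ ⟨e, he, rfl⟩ _ ⟨e', he', rfl⟩
    exact ⟨sumCoordChange E e e', (contMDiffOn_sumCoordChange E e e').continuousOn,
      fun x hx v => sumCoordChange_apply E e e' hx v⟩
  totalSpaceMk_isInducing x := by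
    have h : ∀ i, x ∈ (trivializationAt (E i).Model (E i).Fiber x).baseSet :=
      fun i => mem_baseSet_trivializationAt _ _ x
    exact Topology.isInducing_const_prod.mpr (Topology.IsInducing.piMap fun i =>
      ((trivializationAt (E i).Model (E i).Fiber x).continuousLinearEquivAt ℂ x
        (h i)).toHomeomorph.isInducing)

instance : (sumPrebundle E).IsContMDiff 𝓘(ℂ, ℂ) ω where
  exists_contMDiffCoordChange := by
    rintro _ ⟨e, he, rfl⟩ _ ⟨e', he', rfl⟩
    exact ⟨sumCoordChange E e e', contMDiffOn_sumCoordChange E e e',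
      fun x hx v => sumCoordChange_apply E e e' hx v⟩

/-- The direct sum `⨁ i, E i` of finitely many holomorphic vector bundles; its fibre at `x` is
the direct sum of the fibres. -/
def directSum : HolVectorBundle X :=
  letI := (sumPrebundle E).totalSpaceTopology
  letI := (sumPrebundle E).toFiberBundle
  haveI := (sumPrebundle E).toVectorBundle
  haveI := (sumPrebundle E).contMDiffVectorBundle (n := ω) 𝓘(ℂ, ℂ)
  { Model := ∀ i, (E i).Model
    Fiber := fun x => ∀ i, (E i).Fiber x }

end DirectSum

/-! ### Sheaves of modules and direct images -/

/-- The ring `𝒪_X(U)` of holomorphic functions on `U`. -/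
abbrev HolFun (U : Opens X) : Type := C^ω⟮𝓘(ℂ, ℂ), U; 𝓘(ℂ, ℂ), ℂ⟯

/-- Restriction of holomorphic functions. -/
def HolFun.res {U V : Opens X} (h : V ≤ U) (f : HolFun U) : HolFun V :=
  ⟨fun x => f ⟨x, h x.2⟩, f.contMDiff.comp (contMDiff_inclusion h)⟩

/-- A holomorphic map `φ : Y → X`, as a map `φ⁻¹U → U`. -/
theorem contMDiff_restrictPreimage (φ : C^ω⟮𝓘(ℂ, ℂ), Y; 𝓘(ℂ, ℂ), X⟯) (U : Opens X) :
    ContMDiff 𝓘(ℂ, ℂ) 𝓘(ℂ, ℂ) ω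
      (fun y : U.comap (φ : C(Y, X)) => (⟨φ y, y.2⟩ : U)) := by
  intro y
  exact (ChartedSpace.liftPropWithinAt_subtypeVal_comp_iff _ _ _).mp
    ((φ.contMDiff.comp contMDiff_subtype_val) y)

/-- The composite `f ∘ φ ∈ 𝒪_Y(φ⁻¹U)` of `f ∈ 𝒪_X(U)` with a holomorphic map `φ : Y → X`. -/
def HolFun.comap (φ : C^ω⟮𝓘(ℂ, ℂ), Y; 𝓘(ℂ, ℂ), X⟯) (U : Opens X) :
    HolFun U →+* HolFun (U.comap (φ : C(Y, X))) where
  toFun f := ⟨fun y => f ⟨φ y, y.2⟩, f.contMDiff.comp (contMDiff_restrictPreimage φ U)⟩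
  map_one' := rfl
  map_mul' _ _ := rfl
  map_zero' := rfl
  map_add' _ _ := rfl

/-- A presheaf of `𝒪_X`-modules. A morphism of sheaves of modules is by definition a morphism of the
underlying presheaves; the presheaves used below are sheaves. -/
structure OModule (X : Type) [TopologicalSpace X] [ChartedSpace ℂ X] where
  obj : Opens X → Type
  [addCommMonoid : ∀ U, AddCommMonoid (obj U)]
  [module : ∀ U, Module (HolFun U) (obj U)]
  res : ∀ {U V : Opens X}, V ≤ U → obj U →+ obj V
  res_smul : ∀ {U V : Opens X} (h : V ≤ U) (f : HolFun U) (s : obj U),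
    res h (f • s) = HolFun.res h f • res h s
  res_refl : ∀ (U : Opens X) (s : obj U), res le_rfl s = s
  res_res : ∀ {U V W : Opens X} (h : V ≤ U) (h' : W ≤ V) (s : obj U),
    res h' (res h s) = res (h'.trans h) s

attribute [instance] OModule.addCommMonoid OModule.module

/-- An isomorphism of (pre)sheaves of `𝒪_X`-modules. -/
structure OModule.Iso (M N : OModule X) where
  toEquiv : ∀ U : Opens X, M.obj U ≃ₗ[HolFun U] N.obj U
  naturality : ∀ {U V : Opens X} (h : V ≤ U) (s : M.obj U),
    toEquiv V (M.res h s) = N.res h (toEquiv U s)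

/-- The direct image `φ_*M`: its sections over `U` are those of `M` over `φ⁻¹U`, and `𝒪_X(U)` acts
on them through `f ↦ f ∘ φ`. -/
def OModule.directImage (φ : C^ω⟮𝓘(ℂ, ℂ), Y; 𝓘(ℂ, ℂ), X⟯) (M : OModule Y) : OModule X where
  obj U := M.obj (U.comap (φ : C(Y, X)))
  module U := Module.compHom _ (HolFun.comap φ U)
  res h := M.res (Opens.comap_mono _ h)
  res_smul h f s := M.res_smul (Opens.comap_mono _ h) (HolFun.comap φ _ f) s
  res_refl _ s := M.res_refl _ s
  res_res _ _ s := M.res_res _ _ s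

/-- Being a holomorphic section, in a fixed trivialization. -/
theorem contMDiffAt_section_iff (E : HolVectorBundle X) {U : Opens X} (s : ∀ x : U, E.Fiber x)
    (x₀ : U) :
    ContMDiffAt 𝓘(ℂ, ℂ) (𝓘(ℂ, ℂ).prod 𝓘(ℂ, E.Model)) ω
      (fun x : U => TotalSpace.mk' E.Model (x : X) (s x)) x₀ ↔
    ContMDiffAt 𝓘(ℂ, ℂ) 𝓘(ℂ, E.Model) ω
      (fun x : U => (trivializationAt E.Model E.Fiber (x₀ : X) ⟨x, s x⟩).2) x₀ := by
  rw [contMDiffAt_totalSpace]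
  exact and_iff_right (contMDiff_subtype_val x₀)

theorem eventually_mem_baseSet (E : HolVectorBundle X) {U : Opens X} (x₀ : U) :
    ∀ᶠ x : U in 𝓝 x₀, (x : X) ∈ (trivializationAt E.Model E.Fiber (x₀ : X)).baseSet :=
  continuous_subtype_val.continuousAt.eventually
    ((trivializationAt E.Model E.Fiber (x₀ : X)).open_baseSet.mem_nhds
      (mem_baseSet_trivializationAt E.Model E.Fiber (x₀ : X)))

/-- The space of holomorphic sections of `E` over `U`. -/
def sectionsSubmonoid (E : HolVectorBundle X) (U : Opens X) :
    AddSubmonoid (∀ x : U, E.Fiber x) where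
  carrier := {s | ContMDiff 𝓘(ℂ, ℂ) (𝓘(ℂ, ℂ).prod 𝓘(ℂ, E.Model)) ω
    (fun x : U => TotalSpace.mk' E.Model (x : X) (s x))}
  zero_mem' x₀ := by
    rw [contMDiffAt_section_iff]
    refine (contMDiffAt_const (c := (0 : E.Model))).congr_of_eventuallyEq ?_
    filter_upwards [eventually_mem_baseSet E x₀] with x hx
    exact ((trivializationAt E.Model E.Fiber (x₀ : X)).linear ℂ hx).map_zero
  add_mem' {s t} hs ht x₀ := by
    have hs' := (contMDiffAt_section_iff E s x₀).mp (hs x₀)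
    have ht' := (contMDiffAt_section_iff E t x₀).mp (ht x₀)
    rw [contMDiffAt_section_iff]
    refine (hs'.add ht').congr_of_eventuallyEq ?_
    filter_upwards [eventually_mem_baseSet E x₀] with x hx
    exact ((trivializationAt E.Model E.Fiber (x₀ : X)).linear ℂ hx).map_add (s x) (t x)

/-- The space `𝓔(U)` of holomorphic sections of `E` over `U`. -/
abbrev Sec (E : HolVectorBundle X) (U : Opens X) : Type := sectionsSubmonoid E U

/-- The product of a holomorphic function and a holomorphic section. -/
instance (E : HolVectorBundle X) (U : Opens X) : SMul (HolFun U) (Sec E U) where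
  smul f s := ⟨fun x => f x • s.1 x, fun x₀ => by
    have hs' := (contMDiffAt_section_iff E s.1 x₀).mp (s.2 x₀)
    rw [contMDiffAt_section_iff]
    refine ((f.contMDiff x₀).smul hs').congr_of_eventuallyEq ?_
    filter_upwards [eventually_mem_baseSet E x₀] with x hx
    exact ((trivializationAt E.Model E.Fiber (x₀ : X)).linear ℂ hx).map_smul (f x) (s.1 x)⟩

instance (E : HolVectorBundle X) (U : Opens X) : Module (HolFun U) (Sec E U) where
  one_smul s := Subtype.ext (funext fun x => one_smul ℂ (s.1 x))
  mul_smul f g s := Subtype.ext (funext fun x => mul_smul (f x) (g x) (s.1 x))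
  smul_zero f := Subtype.ext (funext fun x => smul_zero (f x))
  smul_add f s t := Subtype.ext (funext fun x => smul_add (f x) (s.1 x) (t.1 x))
  add_smul f g s := Subtype.ext (funext fun x => add_smul (f x) (g x) (s.1 x))
  zero_smul s := Subtype.ext (funext fun x => zero_smul ℂ (s.1 x))

/-- The sheaf `𝓔` of holomorphic sections of a holomorphic vector bundle `E`. -/
def sheafOfSections (E : HolVectorBundle X) : OModule X where
  obj := Sec E
  res h :=
    { toFun := fun s => ⟨fun x => s.1 ⟨x, h x.2⟩,
        (show ContMDiff _ _ ω _ from s.2).comp (contMDiff_inclusion h)⟩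
      map_zero' := rfl
      map_add' := fun _ _ => rfl }
  res_smul _ _ _ := rfl
  res_refl _ _ := rfl
  res_res _ _ _ := rfl

/-- The holomorphic vector bundle `G` on `X` is the direct image `φ_*F` of the holomorphic vector
bundle `F` on `Y`: the sheaf of sections of `G` is isomorphic, as a sheaf of `𝒪_X`-modules, to the
direct image of the sheaf of sections of `F`. -/
def IsDirectImage (φ : C^ω⟮𝓘(ℂ, ℂ), Y; 𝓘(ℂ, ℂ), X⟯) (F : HolVectorBundle Y)
    (G : HolVectorBundle X) : Prop :=
  Nonempty (OModule.Iso (OModule.directImage φ F.sheafOfSections) G.sheafOfSections)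

end HolVectorBundle
/-! ### Factors of automorphy and the bundles they define -/

open Matrix

/-- An `ι`-dimensional factor of automorphy on `ℂ` for `Γ_τ`: a holomorphic function
`f : Γ_τ × ℂ → GL` with `f(γ + δ, z) = f(γ, δ + z) f(δ, z)`. -/
structure Automorphy (τ : ℍ) (ι : Type) [Fintype ι] [DecidableEq ι] where
  toFun : lattice τ → ℂ → GL ι ℂ
  differentiable : ∀ γ i j, Differentiable ℂ fun z => (toFun γ z : Matrix ι ι ℂ) i j
  cocycle : ∀ (γ δ : lattice τ) (z : ℂ), toFun (γ + δ) z = toFun γ (δ + z) * toFun δ z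

namespace Automorphy

variable {τ : ℍ} {ι : Type} [Fintype ι] [DecidableEq ι] (f : Automorphy τ ι)

theorem toFun_zero (z : ℂ) : f.toFun 0 z = 1 := by
  have h := f.cocycle 0 0 z
  simpa using h

/-- The action of `Γ_τ` on `p_τ⁻¹(x)`. -/
def translate {x : Torus τ} (γ : lattice τ) (z : {z : ℂ // proj τ z = x}) :
    {z : ℂ // proj τ z = x} :=
  ⟨γ + z, (proj_add γ z).trans z.2⟩

/-- The fibre of `E(f) = ℂ × ℂ^ι / Γ_τ` over `x ∈ E_τ`. The group acts by
`γ (z, v) = (γ + z, f(γ, z) v)`; an orbit over `x` is the graph of a function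
`s : p_τ⁻¹(x) → ℂ^ι` with `s(γ + z) = f(γ, z) s(z)`, and we identify orbits with such functions. The
vector space structure is `[z, v] + [z, w] = [z, v + w]`, `c [z, v] = [z, c v]`. -/
def Fiber (x : Torus τ) : Submodule ℂ ({z : ℂ // proj τ z = x} → ι → ℂ) where
  carrier := {s | ∀ γ z, s (translate γ z) = (f.toFun γ z : Matrix ι ι ℂ) *ᵥ s z}
  zero_mem' γ z := by simp
  add_mem' {s t} hs ht γ z := by
    change s _ + t _ = _ *ᵥ (s z + t z)
    rw [hs, ht, mulVec_add]
  smul_mem' c s hs γ z := by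
    change c • s _ = _ *ᵥ (c • s z)
    rw [hs, mulVec_smul]

/-- The lattice vector `w - z` for `z, w ∈ p_τ⁻¹(x)`. -/
def diff {x : Torus τ} (z w : {z : ℂ // proj τ z = x}) : lattice τ :=
  ⟨w - z, proj_eq_iff.mp (z.2.trans w.2.symm)⟩

theorem translate_diff {x : Torus τ} (z w : {z : ℂ // proj τ z = x}) :
    translate (diff z w) z = w :=
  Subtype.ext (by simp [translate, diff])

/-- For `z ∈ p_τ⁻¹(x)`, the isomorphism `[z, v] ↦ v` from the fibre over `x` to `ℂ^ι`. -/
def evalEquiv {x : Torus τ} (z : {z : ℂ // proj τ z = x}) : f.Fiber x ≃ₗ[ℂ] (ι → ℂ) where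
  toFun s := s.1 z
  map_add' _ _ := rfl
  map_smul' _ _ := rfl
  invFun v := ⟨fun w => (f.toFun (diff z w) z : Matrix ι ι ℂ) *ᵥ v, fun γ w => by
    have h : diff z (translate γ w) = γ + diff z w :=
      Subtype.ext (by simp [diff, translate, add_sub_assoc])
    have h' : ((diff z w : lattice τ) : ℂ) + z = w := by simp [diff]
    change (f.toFun (diff z (translate γ w)) z : Matrix ι ι ℂ) *ᵥ v = _
    rw [h, f.cocycle, h', GeneralLinearGroup.coe_mul, mulVec_mulVec]⟩
  left_inv s := by
    refine Subtype.ext (funext fun w => ?_)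
    change _ *ᵥ s.1 z = s.1 w
    rw [← s.2 (diff z w) z, translate_diff]
  right_inv v := by
    have h : diff z z = 0 := Subtype.ext (by simp [diff])
    simp [h, f.toFun_zero]

/-- The class `[z, v]` of `(z, v) ∈ ℂ × ℂ^ι` in the total space of `E(f)`. -/
def cls (p : ℂ × (ι → ℂ)) : TotalSpace (ι → ℂ) (fun x => f.Fiber x) :=
  ⟨proj τ p.1, (f.evalEquiv ⟨p.1, rfl⟩).symm p.2⟩

/-- The matrix `M` as a continuous linear map. -/
def toCLM (M : Matrix ι ι ℂ) : (ι → ℂ) →L[ℂ] (ι → ℂ) :=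
  ∑ i, ∑ j, M i j • (ContinuousLinearMap.single ℂ (fun _ : ι => ℂ) i).comp
    (ContinuousLinearMap.proj (φ := fun _ : ι => ℂ) j)


theorem toCLM_apply (M : Matrix ι ι ℂ) (v : ι → ℂ) : toCLM M v = M *ᵥ v := by
  funext i
  simp [toCLM, Finset.sum_apply, mulVec, dotProduct, Pi.single_apply]

open Classical in
/-- In terms of the local inverse `σ` of `p_τ` at `a`, the map `[σ(x), v] ↦ (x, v)`. -/
def trivFun (a : ℂ) (p : TotalSpace (ι → ℂ) (fun x => f.Fiber x)) : Torus τ × (ι → ℂ) :=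
  (p.1, if h : p.1 ∈ (localInv τ a).source then
    f.evalEquiv ⟨localInv τ a p.1, proj_localInv h⟩ p.2 else 0)

open Classical in
/-- In terms of the local inverse `σ` of `p_τ` at `a`, the map `(x, v) ↦ [σ(x), v]`. -/
def trivInv (a : ℂ) (p : Torus τ × (ι → ℂ)) : TotalSpace (ι → ℂ) (fun x => f.Fiber x) :=
  ⟨p.1, if h : p.1 ∈ (localInv τ a).source then
    (f.evalEquiv ⟨localInv τ a p.1, proj_localInv h⟩).symm p.2 else 0⟩

theorem trivFun_apply {a : ℂ} {x : Torus τ} (hx : x ∈ (localInv τ a).source)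
    (s : f.Fiber x) : f.trivFun a ⟨x, s⟩ =
      (x, f.evalEquiv ⟨localInv τ a x, proj_localInv hx⟩ s) := by
  simp [trivFun, hx]

theorem trivInv_apply {a : ℂ} {x : Torus τ} (hx : x ∈ (localInv τ a).source)
    (v : ι → ℂ) : f.trivInv a (x, v) =
      ⟨x, (f.evalEquiv ⟨localInv τ a x, proj_localInv hx⟩).symm v⟩ := by
  simp [trivInv, hx]

/-- The trivialization of `E(f)` over the domain of the local inverse `σ` of `p_τ` at `a`:
`[σ(x), v] ↦ (x, v)`. -/
def pretrivialization (a : ℂ) :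
    Pretrivialization (ι → ℂ) (π (ι → ℂ) (fun x => f.Fiber x)) where
  toFun := f.trivFun a
  invFun := f.trivInv a
  baseSet := (localInv τ a).source
  source := {p | p.1 ∈ (localInv τ a).source}
  target := (localInv τ a).source ×ˢ univ
  map_source' _ hp := mk_mem_prod hp (mem_univ _)
  map_target' _ hp := hp.1
  left_inv' := by
    rintro ⟨x, s⟩ (hx : x ∈ (localInv τ a).source)
    rw [f.trivFun_apply hx, f.trivInv_apply hx, LinearEquiv.symm_apply_apply]
  right_inv' := by
    rintro ⟨x, v⟩ ⟨hx : x ∈ (localInv τ a).source, -⟩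
    rw [f.trivInv_apply hx, f.trivFun_apply hx, LinearEquiv.apply_symm_apply]
  open_target := (localInv τ a).open_source.prod isOpen_univ
  open_baseSet := (localInv τ a).open_source
  source_eq := rfl
  target_eq := rfl
  proj_toFun _ _ := rfl

theorem pretrivialization_apply {a : ℂ} {x : Torus τ} (hx : x ∈ (localInv τ a).source)
    (s : f.Fiber x) : f.pretrivialization a ⟨x, s⟩ =
      (x, f.evalEquiv ⟨localInv τ a x, proj_localInv hx⟩ s) :=
  f.trivFun_apply hx s

theorem pretrivialization_symm {a : ℂ} {x : Torus τ} (hx : x ∈ (localInv τ a).source)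
    (v : ι → ℂ) : (f.pretrivialization a).symm x v =
      (f.evalEquiv ⟨localInv τ a x, proj_localInv hx⟩).symm v := by
  rw [Pretrivialization.symm_apply _ (show x ∈ (f.pretrivialization a).baseSet from hx)]
  have h : (f.pretrivialization a).toPartialEquiv.symm (x, v) =
      ⟨x, (f.evalEquiv ⟨localInv τ a x, proj_localInv hx⟩).symm v⟩ := f.trivInv_apply hx v
  rw [cast_eq_iff_heq, h]

open Classical in
/-- The transition functions `x ↦ f(σ_b(x) - σ_a(x), σ_a(x))` of `E(f)`. -/
def coordChange (a b : ℂ) (x : Torus τ) : (ι → ℂ) →L[ℂ] (ι → ℂ) :=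
  if h : x ∈ (localInv τ a).source ∧ x ∈ (localInv τ b).source then
    toCLM (f.toFun (diff (x := x) ⟨localInv τ a x, proj_localInv h.1⟩
      ⟨localInv τ b x, proj_localInv h.2⟩) (localInv τ a x)) else 0

theorem coordChange_apply {a b : ℂ} {x : Torus τ}
    (h : x ∈ (localInv τ a).source ∩ (localInv τ b).source) (v : ι → ℂ) :
    f.coordChange a b x v =
      (f.pretrivialization b ⟨x, (f.pretrivialization a).symm x v⟩).2 := by
  rw [f.pretrivialization_symm h.1, f.pretrivialization_apply h.2]
  have h' : x ∈ (localInv τ a).source ∧ x ∈ (localInv τ b).source := h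
  rw [coordChange, dif_pos h', toCLM_apply]
  rfl

theorem contMDiffOn_coordChange (a b : ℂ) :
    ContMDiffOn 𝓘(ℂ, ℂ) 𝓘(ℂ, (ι → ℂ) →L[ℂ] (ι → ℂ)) ω (f.coordChange a b)
      ((localInv τ a).source ∩ (localInv τ b).source) := by
  intro x hx
  refine ContMDiffAt.contMDiffWithinAt ?_
  obtain ⟨γ, hγ⟩ := localInv_sub_eventuallyEq hx.1 hx.2
  have hloc : ContMDiffAt 𝓘(ℂ, ℂ) 𝓘(ℂ, (ι → ℂ) →L[ℂ] (ι → ℂ)) ω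
      (fun y => toCLM (f.toFun γ (localInv τ a y) : Matrix ι ι ℂ)) x := by
    unfold toCLM
    refine contMDiffAt_finsetSum fun i _ => contMDiffAt_finsetSum fun j _ => ?_
    have h : ContMDiff 𝓘(ℂ, ℂ) 𝓘(ℂ, ℂ) ω (fun z => (f.toFun γ z : Matrix ι ι ℂ) i j) :=
      (f.differentiable γ i j).contDiff.contMDiff
    have h' : ContMDiffAt 𝓘(ℂ, ℂ) 𝓘(ℂ, ℂ) ω
        (fun y => (f.toFun γ (localInv τ a y) : Matrix ι ι ℂ) i j) x :=
      h.contMDiffAt.comp x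
        ((contMDiffOn_localInv τ a).contMDiffAt ((localInv τ a).open_source.mem_nhds hx.1))
    exact h'.smul contMDiffAt_const
  refine hloc.congr_of_eventuallyEq ?_
  filter_upwards [hγ, (localInv τ a).open_source.mem_nhds hx.1,
    (localInv τ b).open_source.mem_nhds hx.2] with y hy hya hyb
  have h' : y ∈ (localInv τ a).source ∧ y ∈ (localInv τ b).source := ⟨hya, hyb⟩
  rw [coordChange, dif_pos h']
  have : diff (x := y) ⟨localInv τ a y, proj_localInv hya⟩
      ⟨localInv τ b y, proj_localInv hyb⟩ = γ := Subtype.ext (by simp [diff, hy])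
  rw [this]

/-- Evaluation at a point identifies the topological vector space `E(f)_x` with `ℂ^ι`. -/
theorem isInducing_evalEquiv {x : Torus τ} (z : {z : ℂ // proj τ z = x}) :
    Topology.IsInducing (f.evalEquiv z) := by
  have h1 : Continuous (f.evalEquiv z) := (continuous_apply z).comp continuous_subtype_val
  have h2 : Continuous (f.evalEquiv z).symm := by
    refine Continuous.subtype_mk (continuous_pi fun w => ?_) _
    exact Continuous.matrix_mulVec continuous_const continuous_id
  exact (Homeomorph.mk (f.evalEquiv z).toEquiv h1 h2).isInducing

/-- The vector prebundle of `E(f)`. -/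
def prebundle : VectorPrebundle ℂ (ι → ℂ) (fun x => f.Fiber x) where
  pretrivializationAtlas := range f.pretrivialization
  pretrivialization_linear' := by
    rintro _ ⟨a, rfl⟩
    refine ⟨fun x (hx : x ∈ (localInv τ a).source) => ⟨fun s t => ?_, fun c s => ?_⟩⟩ <;>
      simp only [f.pretrivialization_apply hx]
    · exact map_add _ s t
    · exact map_smul _ c s
  pretrivializationAt x := f.pretrivialization (lift x)
  mem_base_pretrivializationAt x := mem_localInv_lift_source x
  pretrivialization_mem_atlas x := mem_range_self _
  exists_coordChange := by
    rintro _ ⟨a, rfl⟩ _ ⟨b, rfl⟩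
    exact ⟨f.coordChange a b, (f.contMDiffOn_coordChange a b).continuousOn,
      fun x hx v => f.coordChange_apply hx v⟩
  totalSpaceMk_isInducing x := by
    have h : f.pretrivialization (lift x) ∘ TotalSpace.mk x = fun s => (x,
        f.evalEquiv ⟨localInv τ (lift x) x, proj_localInv (mem_localInv_lift_source x)⟩ s) :=
      funext fun s => f.pretrivialization_apply (mem_localInv_lift_source x) s
    rw [h]
    exact Topology.isInducing_const_prod.mpr (f.isInducing_evalEquiv _)

instance : f.prebundle.IsContMDiff 𝓘(ℂ, ℂ) ω where
  exists_contMDiffCoordChange := by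
    rintro _ ⟨a, rfl⟩ _ ⟨b, rfl⟩
    exact ⟨f.coordChange a b, f.contMDiffOn_coordChange a b,
      fun x hx v => f.coordChange_apply hx v⟩

/-- The holomorphic vector bundle `E(f) = ℂ × ℂ^ι / Γ_τ` on `E_τ`. -/
def bundle : HolVectorBundle (Torus τ) :=
  letI := f.prebundle.totalSpaceTopology
  letI := f.prebundle.toFiberBundle
  haveI := f.prebundle.toVectorBundle
  haveI := f.prebundle.contMDiffVectorBundle (n := ω) 𝓘(ℂ, ℂ)
  { Model := ι → ℂ
    Fiber := fun x => f.Fiber x }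

/-- The total space of `E(f)` is, as a set, the quotient of `ℂ × ℂ^ι` by `Γ_τ`. -/
theorem cls_surjective : Function.Surjective f.cls := by
  rintro ⟨x, s⟩
  obtain ⟨z, rfl⟩ := proj_surjective τ x
  exact ⟨(z, f.evalEquiv ⟨z, rfl⟩ s), by simp [cls]⟩

/-- Two pairs have the same class if and only if they lie in the same orbit. -/
theorem cls_eq_cls_iff (p p' : ℂ × (ι → ℂ)) : f.cls p = f.cls p' ↔
    ∃ γ : lattice τ, p' = (γ + p.1, (f.toFun γ p.1 : Matrix ι ι ℂ) *ᵥ p.2) := by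
  obtain ⟨z, v⟩ := p
  obtain ⟨z', v'⟩ := p'
  constructor
  · intro h
    have h1 : proj τ z = proj τ z' := congrArg TotalSpace.proj h
    have key : ∀ (x : Torus τ) (h1 : proj τ z = x) (h2 : proj τ z' = x),
        (f.evalEquiv ⟨z, h1⟩).symm v = (f.evalEquiv ⟨z', h2⟩).symm v' →
        v' = (f.toFun (diff ⟨z, h1⟩ ⟨z', h2⟩) z : Matrix ι ι ℂ) *ᵥ v := by
      intro x h1 h2 h3
      have h4 := congrArg (f.evalEquiv ⟨z', h2⟩) h3
      rw [LinearEquiv.apply_symm_apply] at h4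
      exact h4.symm
    refine ⟨⟨z' - z, proj_eq_iff.mp h1⟩, Prod.ext (by simp) (key (proj τ z) rfl h1.symm ?_)⟩
    have gen : ∀ (x : Torus τ) (h2 : proj τ z' = x) (s : f.Fiber x),
        (⟨x, s⟩ : TotalSpace (ι → ℂ) (fun x => f.Fiber x)) = f.cls (z', v') →
        s = (f.evalEquiv ⟨z', h2⟩).symm v' := by
      rintro _ rfl s hs
      exact eq_of_heq ((TotalSpace.mk.injEq ..).mp hs).2
    exact gen _ h1.symm _ h
  · rintro ⟨γ, h⟩
    simp only [Prod.mk.injEq] at h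
    obtain ⟨rfl, rfl⟩ := h
    have gen : ∀ (x : Torus τ) (h1 : proj τ z = x) (h2 : proj τ (γ + z) = x),
        (⟨x, (f.evalEquiv ⟨z, h1⟩).symm v⟩ : TotalSpace (ι → ℂ) (fun x => f.Fiber x)) =
        f.cls (γ + z, (f.toFun γ z : Matrix ι ι ℂ) *ᵥ v) := by
      intro x h1 h2
      subst h2
      refine congrArg (TotalSpace.mk _) ?_
      rw [LinearEquiv.eq_symm_apply]
      have : diff (x := proj τ (γ + z)) ⟨z, h1⟩ ⟨γ + z, rfl⟩ = γ := Subtype.ext (by simp [diff])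
      change (f.toFun (diff (x := proj τ (γ + z)) ⟨z, h1⟩ ⟨γ + z, rfl⟩) z : Matrix ι ι ℂ) *ᵥ v = _
      rw [this]
    exact gen _ rfl (proj_add γ z)

/-- The topology of `E(f)` is the quotient topology. -/
theorem isQuotientMap_cls :
    @Topology.IsQuotientMap _ _ _ f.bundle.topologicalSpaceTotal f.cls := by
  let _ : TopologicalSpace (TotalSpace (ι → ℂ) (fun x => f.Fiber x)) :=
    f.prebundle.totalSpaceTopology
  change Topology.IsQuotientMap f.cls
  have hloc : IsLocalHomeomorph f.cls := by
    refine IsLocalHomeomorph.mk _ fun p => ?_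
    let e := f.prebundle.trivializationOfMemPretrivializationAtlas (mem_range_self p.1)
    have hp : p.1 ∈ (localInv τ p.1).target :=
      (isLocalHomeomorph_proj τ).self_mem_localInverseAt_target
    have hsource : ∀ q : ℂ × (ι → ℂ), q.1 ∈ (localInv τ p.1).target →
        (proj τ q.1, q.2) ∈ e.target := fun q hq => by
      refine mk_mem_prod (?_ : proj τ q.1 ∈ (localInv τ p.1).source) (mem_univ _)
      have := (localInv τ p.1).map_target hq
      rwa [localInv_symm] at this
    refine ⟨((localInv τ p.1).symm.prod (OpenPartialHomeomorph.refl (ι → ℂ))).trans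
      e.toOpenPartialHomeomorph.symm, ⟨⟨hp, mem_univ _⟩, ?_⟩, ?_⟩
    · change ((localInv τ p.1).symm p.1, p.2) ∈ e.target
      rw [localInv_symm]
      exact hsource p hp
    · rintro ⟨w, v⟩ ⟨⟨hw : w ∈ (localInv τ p.1).target, -⟩, -⟩
      change f.cls (w, v) = f.trivInv p.1 ((localInv τ p.1).symm w, v)
      have h1 : proj τ w ∈ (localInv τ p.1).source := (hsource (w, v) hw).1
      have h2 : localInv τ p.1 (proj τ w) = w := by
        have := (localInv τ p.1).right_inv hw
        rwa [localInv_symm] at this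
      rw [localInv_symm, f.trivInv_apply h1]
      have h3 : (⟨localInv τ p.1 (proj τ w), proj_localInv h1⟩ :
          {z : ℂ // proj τ z = proj τ w}) = ⟨w, rfl⟩ := Subtype.ext h2
      rw [h3]
      rfl
  exact hloc.isOpenMap.isQuotientMap hloc.continuous f.cls_surjective

end Automorphy

/-- The unit `e^{2πiz} ∈ ℂ^*`. -/
def expUnit (z : ℂ) : ℂˣ :=
  Units.mk0 (Complex.exp (2 * Real.pi * Complex.I * z)) (Complex.exp_ne_zero _)

theorem expUnit_add (z w : ℂ) : expUnit (z + w) = expUnit z * expUnit w :=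
  Units.ext (by simp [expUnit, mul_add, Complex.exp_add])

theorem expUnit_intCast (n : ℤ) : expUnit n = 1 :=
  Units.ext (by
    have := Complex.exp_int_mul_two_pi_mul_I n
    simpa [expUnit, mul_comm, mul_left_comm, mul_assoc] using this)

theorem expUnit_intCast_mul (m : ℤ) (z : ℂ) : expUnit (m * z) = expUnit z ^ m :=
  Units.ext (by
    have := Complex.exp_int_mul (2 * Real.pi * Complex.I * z) m
    rw [Units.val_zpow_eq_zpow_val]
    simpa [expUnit, mul_comm, mul_left_comm, mul_assoc] using this)

theorem contMDiff_expUnit : ContMDiff 𝓘(ℂ, ℂ) 𝓘(ℂ, ℂ) ω expUnit := by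
  apply ContMDiff.of_comp_isOpenEmbedding Units.isOpenEmbedding_val
  have h : Differentiable ℂ fun z : ℂ => Complex.exp (2 * Real.pi * Complex.I * z) := by fun_prop
  exact h.contDiff.contMDiff

/-- The number `q = e^{2πiτ}`. -/
def nome (τ : ℍ) : ℂˣ := expUnit τ

/-- A holomorphic function `A : ℂ^* → GL`. -/
structure HolGL (ι : Type) [Fintype ι] [DecidableEq ι] where
  toFun : ℂˣ → GL ι ℂ
  contMDiff : ∀ i j, ContMDiff 𝓘(ℂ, ℂ) 𝓘(ℂ, ℂ) ω fun u => (toFun u : Matrix ι ι ℂ) i j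

namespace HolGL

variable {ι : Type} [Fintype ι] [DecidableEq ι] (A : HolGL ι)

/-- `A(m, u) = A(q^{m-1}u) ⋯ A(qu) A(u)` for `m ∈ ℕ`. -/
def iterNat (q : ℂˣ) : ℕ → ℂˣ → GL ι ℂ
  | 0, _ => 1
  | m + 1, u => A.toFun (q ^ m * u) * iterNat q m u

/-- `A(m, u)` for `m ∈ ℤ`: it is `A(q^{m-1}u) ⋯ A(qu) A(u)` for `m ≥ 0`, and
`A(-m, u) = A(m, q^{-m}u)⁻¹ = A(q^{-m}u)⁻¹ ⋯ A(q^{-1}u)⁻¹` for `m > 0`. -/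
def iter (q : ℂˣ) : ℤ → ℂˣ → GL ι ℂ
  | Int.ofNat m, u => A.iterNat q m u
  | Int.negSucc m, u => (A.iterNat q (m + 1) ((q ^ (m + 1))⁻¹ * u))⁻¹

theorem iterNat_succ' (q : ℂˣ) (m : ℕ) (u : ℂˣ) :
    A.iterNat q (m + 1) u = A.iterNat q m (q * u) * A.toFun u := by
  induction m with
  | zero => simp [iterNat]
  | succ m ih =>
    rw [iterNat, ih, iterNat, mul_assoc, pow_succ, mul_assoc]

theorem iter_succ (q : ℂˣ) (m : ℤ) (u : ℂˣ) :
    A.iter q (m + 1) u = A.toFun (q ^ m * u) * A.iter q m u := by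
  match m with
  | Int.ofNat m => rfl
  | Int.negSucc 0 =>
    change A.iterNat q 0 u = _ * (A.iterNat q 1 _)⁻¹
    simp [iterNat]
  | Int.negSucc (m + 1) =>
    have h : Int.negSucc (m + 1) + 1 = Int.negSucc m := by omega
    have e1 : (q ^ Int.negSucc (m + 1) : ℂˣ) * u = (q ^ (m + 1 + 1))⁻¹ * u := by
      rw [zpow_negSucc]
    have e2 : q * ((q ^ (m + 1 + 1))⁻¹ * u) = (q ^ (m + 1))⁻¹ * u := by
      rw [pow_succ q (m + 1), _root_.mul_inv_rev, mul_assoc, mul_inv_cancel_left]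
    rw [h, e1]
    change (A.iterNat q (m + 1) _)⁻¹ = _ * (A.iterNat q (m + 1 + 1) _)⁻¹
    rw [A.iterNat_succ' q (m + 1), e2, _root_.mul_inv_rev, mul_inv_cancel_left]

theorem iter_zero (q u : ℂˣ) : A.iter q 0 u = 1 := rfl

theorem iter_add (q : ℂˣ) (m k : ℤ) (u : ℂˣ) :
    A.iter q (m + k) u = A.iter q m (q ^ k * u) * A.iter q k u := by
  induction m using Int.induction_on with
  | zero => simp [iter_zero]
  | succ m ih =>
    rw [add_right_comm, iter_succ, ih, iter_succ, _root_.zpow_add, mul_assoc, mul_assoc]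
  | pred m ih =>
    have h1 := A.iter_succ q (-(m : ℤ) - 1 + k) u
    have h2 := A.iter_succ q (-(m : ℤ) - 1) (q ^ k * u)
    rw [show -(m : ℤ) - 1 + k + 1 = -m + k by ring, ih] at h1
    rw [sub_add_cancel] at h2
    rw [h2, _root_.zpow_add, mul_assoc, mul_assoc] at h1
    exact (mul_left_cancel h1).symm

theorem differentiable_toFun_exp (c : ℂˣ) (i j : ι) :
    Differentiable ℂ fun z => (A.toFun (c * expUnit z) : Matrix ι ι ℂ) i j := by
  have h : ContMDiff 𝓘(ℂ, ℂ) 𝓘(ℂ, ℂ) ω fun z : ℂ => c * expUnit z :=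
    (contMDiff_mul_left (I := 𝓘(ℂ, ℂ)) (a := c)).comp contMDiff_expUnit
  exact (((A.contMDiff i j).comp h).contDiff).differentiable (by simp)

theorem differentiable_iterNat (q c : ℂˣ) (m : ℕ) (i j : ι) :
    Differentiable ℂ fun z => (A.iterNat q m (c * expUnit z) : Matrix ι ι ℂ) i j := by
  induction m generalizing i j with
  | zero => exact differentiable_const _
  | succ m ih =>
    simp only [iterNat, GeneralLinearGroup.coe_mul, mul_apply, ← mul_assoc]
    exact Differentiable.fun_sum fun k _ => (A.differentiable_toFun_exp _ i k).mul (ih k j)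

theorem differentiable_inv {M : ℂ → GL ι ℂ}
    (hM : ∀ i j, Differentiable ℂ fun z => (M z : Matrix ι ι ℂ) i j) (i j : ι) :
    Differentiable ℂ fun z => ((M z)⁻¹ : GL ι ℂ).1 i j := by
  have hdet : ∀ N : ℂ → Matrix ι ι ℂ, (∀ i j, Differentiable ℂ fun z => N z i j) →
      Differentiable ℂ fun z => (N z).det := by
    intro N hN
    simp only [det_apply']
    exact Differentiable.fun_sum fun σ _ => (differentiable_const _).mul
      (Differentiable.fun_finsetProd fun k _ => hN _ _)
  have h0 : ∀ z, (M z : Matrix ι ι ℂ).det ≠ 0 := fun z =>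
    ((isUnit_iff_isUnit_det _).mp (M z).isUnit).ne_zero
  have h1 : ∀ z, ((M z)⁻¹ : GL ι ℂ).1 i j =
      ((M z : Matrix ι ι ℂ).det)⁻¹ * ((M z : Matrix ι ι ℂ).updateRow j (Pi.single i 1)).det := by
    intro z
    rw [coe_units_inv, inv_def, Ring.inverse_eq_inv', Matrix.smul_apply, smul_eq_mul,
      adjugate_apply]
  simp only [h1]
  refine (Differentiable.fun_inv (hdet _ hM) h0).mul (hdet _ fun k l => ?_)
  by_cases hk : k = j
  · simp only [updateRow_apply, if_pos hk]
    exact differentiable_const _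
  · simp only [updateRow_apply, if_neg hk]
    exact hM k l

/-- The factor of automorphy on `ℂ` for `Γ_τ` defined by `A`:
`f(mτ + n, z) = A(m, e^{2πiz})`, where `A(m, u)` is formed with `q = e^{2πiτ}`. -/
def automorphy (τ : ℍ) : Automorphy τ ι where
  toFun γ z := A.iter (nome τ) (tauCoeff γ) (expUnit z)
  differentiable γ i j := by
    cases tauCoeff γ with
    | ofNat m => simpa [iter] using A.differentiable_iterNat (nome τ) 1 m i j
    | negSucc m => exact differentiable_inv (A.differentiable_iterNat (nome τ) _ (m + 1)) i j
  cocycle γ δ z := by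
    obtain ⟨n, hn⟩ := exists_eq_tauCoeff δ
    have h : expUnit (δ + z) = nome τ ^ tauCoeff δ * expUnit z := by
      rw [hn, expUnit_add, expUnit_add, expUnit_intCast, mul_one, expUnit_intCast_mul, nome]
    rw [tauCoeff_add, iter_add, h]

/-- The holomorphic vector bundle `E(A)` on `E_τ`. -/
def bundle (τ : ℍ) : HolVectorBundle (Torus τ) := (A.automorphy τ).bundle

/-- The function `u ↦ A(cu)`. -/
def shift (c : ℂˣ) : HolGL ι where
  toFun u := A.toFun (c * u)
  contMDiff i j := (A.contMDiff i j).comp (contMDiff_mul_left (I := 𝓘(ℂ, ℂ)) (a := c))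

theorem blockDiag_mul {r : ℕ} {M N : Fin r → Matrix ι ι ℂ} (h : ∀ k, M k * N k = 1) :
    (of fun p p' : Fin r × ι => if p.1 = p'.1 then M p.1 p.2 p'.2 else 0) *
      (of fun p p' : Fin r × ι => if p.1 = p'.1 then N p.1 p.2 p'.2 else 0) = 1 := by
  ext ⟨k, i⟩ ⟨l, j⟩
  rw [mul_apply, Fintype.sum_prod_type, Finset.sum_eq_single k]
  · by_cases hl : k = l
    · subst hl
      simp only [of_apply, if_true, ← mul_apply, h, one_apply, Prod.mk.injEq, true_and]
    · rw [one_apply_ne (by simp [hl])]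
      simp [hl]
  · intro m _ hm
    exact Finset.sum_eq_zero fun a _ => by simp [Ne.symm hm]
  · simp

/-- The block-diagonal matrix `diag(B_0, …, B_{r-1})`. -/
def blockDiag {r : ℕ} (B : Fin r → HolGL ι) : HolGL (Fin r × ι) where
  toFun u :=
    { val := of fun p p' => if p.1 = p'.1 then ((B p.1).toFun u).1 p.2 p'.2 else 0
      inv := of fun p p' => if p.1 = p'.1 then ((B p.1).toFun u)⁻¹.1 p.2 p'.2 else 0
      val_inv := blockDiag_mul (M := fun k => ((B k).toFun u).1) (N := fun k => ((B k).toFun u)⁻¹.1)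
        fun k => Units.mul_inv ((B k).toFun u)
      inv_val := blockDiag_mul (M := fun k => ((B k).toFun u)⁻¹.1) (N := fun k => ((B k).toFun u).1)
        fun k => Units.inv_mul ((B k).toFun u) }
  contMDiff := by
    rintro ⟨a, i⟩ ⟨b, j⟩
    by_cases h : a = b
    · simpa [h] using (B b).contMDiff i j
    · simpa [h] using contMDiff_const

theorem companion_mul {r : ℕ} [NeZero r] {M N : Matrix ι ι ℂ} (h : M * N = 1) :
    (of fun p p' : Fin r × ι =>
        if (p.1 : ℕ) + 1 = p'.1 then (1 : Matrix ι ι ℂ) p.2 p'.2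
        else if (p.1 : ℕ) + 1 = r ∧ (p'.1 : ℕ) = 0 then M p.2 p'.2 else 0) *
      (of fun p p' : Fin r × ι =>
        if (p'.1 : ℕ) + 1 = p.1 then (1 : Matrix ι ι ℂ) p.2 p'.2
        else if (p'.1 : ℕ) + 1 = r ∧ (p.1 : ℕ) = 0 then N p.2 p'.2 else 0) = 1 := by
  ext ⟨k, i⟩ ⟨l, j⟩
  rw [mul_apply, Fintype.sum_prod_type]
  simp only [of_apply]
  by_cases hk : (k : ℕ) + 1 = r
  · rw [Finset.sum_eq_single (0 : Fin r)]
    · have e : ∀ a, (if (k : ℕ) + 1 = ((0 : Fin r) : ℕ) then (1 : Matrix ι ι ℂ) i a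
          else if (k : ℕ) + 1 = r ∧ ((0 : Fin r) : ℕ) = 0 then M i a else 0) = M i a := by
        intro a
        rw [if_neg (by simp), if_pos ⟨hk, by simp⟩]
      simp only [e]
      by_cases hl : l = k
      · subst hl
        have e' : ∀ a, (if (l : ℕ) + 1 = ((0 : Fin r) : ℕ) then (1 : Matrix ι ι ℂ) a j
            else if (l : ℕ) + 1 = r ∧ ((0 : Fin r) : ℕ) = 0 then N a j else 0) = N a j := by
          intro a
          rw [if_neg (by simp), if_pos ⟨hk, by simp⟩]
        have h1 := congrFun (congrFun h i) j
        rw [mul_apply] at h1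
        rw [Finset.sum_congr rfl fun a _ => by rw [e']]
        refine h1.trans ?_
        simp only [one_apply, Prod.mk.injEq, true_and]
      · have hl' : (l : ℕ) + 1 ≠ r := fun h' => hl (Fin.ext (by omega))
        rw [one_apply_ne (by simp [Ne.symm hl])]
        refine Finset.sum_eq_zero fun a _ => ?_
        rw [if_neg (c := (l : ℕ) + 1 = ((0 : Fin r) : ℕ)) (by simp), if_neg (by simp [hl']),
          mul_zero]
    · intro m _ hm
      refine Finset.sum_eq_zero fun a _ => ?_
      have hm0 : (m : ℕ) ≠ 0 := fun h' => hm (Fin.ext (by simpa using h'))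
      rw [if_neg (by have := m.2; omega), if_neg (by simp [hm0]), zero_mul]
    · simp
  · have hk' : (k : ℕ) + 1 < r := by have := k.2; omega
    rw [Finset.sum_eq_single (⟨k + 1, hk'⟩ : Fin r)]
    · simp only [if_true]
      rw [Finset.sum_eq_single i]
      · by_cases hl : l = k
        · subst hl
          simp [one_apply]
        · have : (l : ℕ) ≠ k := fun h' => hl (Fin.ext h')
          simp [Ne.symm hl, this, one_apply]
      · intro a _ ha
        rw [one_apply_ne (Ne.symm ha), zero_mul]
      · simp
    · intro m _ hm
      refine Finset.sum_eq_zero fun a _ => ?_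
      have : (k : ℕ) + 1 ≠ m := fun h' => hm (Fin.ext h'.symm)
      rw [if_neg this, if_neg (by simp [hk]), zero_mul]
    · simp

/-- The block matrix `[[0, I_{(r-1)n}], [A(u), 0]]` with `n × n` blocks. Its rows and columns are
indexed by `Fin r × ι`, the first component being the number of the block: the blocks `(k, k + 1)`
are `I_n`, the block `(r - 1, 0)` is `A(u)`, and all other blocks vanish. -/
def companion (r : ℕ) [NeZero r] : HolGL (Fin r × ι) where
  toFun u :=
    { val := of fun p p' =>
        if (p.1 : ℕ) + 1 = p'.1 then (1 : Matrix ι ι ℂ) p.2 p'.2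
        else if (p.1 : ℕ) + 1 = r ∧ (p'.1 : ℕ) = 0 then (A.toFun u).1 p.2 p'.2 else 0
      inv := of fun p p' =>
        if (p'.1 : ℕ) + 1 = p.1 then (1 : Matrix ι ι ℂ) p.2 p'.2
        else if (p'.1 : ℕ) + 1 = r ∧ (p.1 : ℕ) = 0 then (A.toFun u)⁻¹.1 p.2 p'.2 else 0
      val_inv := companion_mul (A.toFun u).mul_inv
      inv_val := mul_eq_one_comm.mp (companion_mul (A.toFun u).mul_inv) }
  contMDiff := by
    rintro ⟨a, i⟩ ⟨b, j⟩
    by_cases h : (a : ℕ) + 1 = b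
    · simp only [of_apply, if_pos h]
      exact contMDiff_const
    · by_cases h' : (a : ℕ) + 1 = r ∧ (b : ℕ) = 0
      · simp only [of_apply, if_neg h, if_pos h']
        exact A.contMDiff i j
      · simp only [of_apply, if_neg h, if_neg h']
        exact contMDiff_const

end HolGL

end

end EllVB

open EllVB

namespace EllVB

open scoped UpperHalfPlane Manifold ContDiff Topology Bundle
open Bundle Set TopologicalSpace

noncomputable section

/-! Let p_τ : ℂ → E_τ be the projection. The pullback of E(A) to ℂ is trivial, and the sections over
U become the holomorphic functions g on p_τ⁻¹(U) with g(z + 1) = g(z) and g(z + τ) = A(e^{2πiz})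
g(z) (`Unif.secIso`). The bundle enters only through this multiplier, the matrix attached to
translation by τ.

Since p_τ = π_r ∘ p_{rτ}, a section over U of the direct image of E(A) is a function g on the same
open set p_τ⁻¹(U), equivariant for rτ instead of τ. Stacking translates, G(z) = (g(z), g(z + τ), …,
g(z + (r-1)τ)), turns equivariance for rτ into equivariance for τ with the companion matrix as
multiplier: translation by τ shifts the blocks, and the block g(z + rτ) that enters at the end is A
g(z). The first block of G recovers g. This is `autoSheafDirectImage`, the existence half of (1).

The uniqueness half holds because a bundle is determined by its sheaf of sections
(`isIsomorphic_of_iso`): by expansion in a local frame, an 𝒪-linear morphism of sheaves sends a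
section to one whose value at x depends only on the value of the given section at x
(`SecHom.fiberMap_apply`), so it comes from a holomorphic family of linear maps of fibres.

For (2), the direct image may be replaced by the companion bundle. Pullback along π_r keeps the
trivialization on ℂ, and the multiplier for rτ is the product of the companion matrices at z, z + τ,
…, z + (r-1)τ, which is diag(A(u), A(qu), …, A(q^{r-1}u)) (`HolGL.companion_iterate_self`). The
direct sum has the same multiplier, and so has the block-diagonal bundle once its blocks are listed
in reverse; equal multipliers give isomorphic bundles (`Unif.IsMultiplier.isIsomorphic`). -/

/-! ### Two tools for checking holomorphy -/

/-- A family of linear maps which depends holomorphically on a parameter, applied to a vector which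
depends holomorphically on the parameter. -/
theorem contMDiffAt_linearMap_apply {M H E' : Type*} [NormedAddCommGroup E'] [NormedSpace ℂ E']
    [TopologicalSpace H] {I : ModelWithCorners ℂ E' H} [TopologicalSpace M] [ChartedSpace H M]
    {V W : Type*} [NormedAddCommGroup V] [NormedSpace ℂ V] [FiniteDimensional ℂ V]
    [NormedAddCommGroup W] [NormedSpace ℂ W] (L : M → V →ₗ[ℂ] W) {g : M → V} {x : M}
    (hL : ∀ v, ContMDiffAt I 𝓘(ℂ, W) ω (fun y => L y v) x)
    (hg : ContMDiffAt I 𝓘(ℂ, V) ω g x) :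
    ContMDiffAt I 𝓘(ℂ, W) ω (fun y => L y (g y)) x := by
  let b := Module.finBasis ℂ V
  -- Holomorphy of `L` is known only one vector at a time, so `g y` is expanded in a fixed basis;
  -- its coefficients are fixed linear functionals of `g y`.
  have h : (fun y => L y (g y)) = fun y => ∑ i, b.coord i (g y) • L y (b i) := by
    funext y
    conv_lhs => rw [← b.sum_repr (g y)]
    simp only [map_sum, map_smul, Module.Basis.coord_apply]
  rw [h]
  refine contMDiffAt_finsetSum fun i _ => ?_
  have h1 : ContMDiffAt I 𝓘(ℂ, ℂ) ω (fun y => b.coord i (g y)) x :=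
    (LinearMap.toContinuousLinearMap (b.coord i)).contMDiff.contMDiffAt.comp x hg
  exact h1.smul (hL (b i))

/-- Holomorphy of a function on an open set, by comparison with another function along a
holomorphic map. -/
theorem contMDiffAt_of_eventuallyEq_comp {M N H H' E' E'' V : Type*}
    [NormedAddCommGroup E'] [NormedSpace ℂ E'] [TopologicalSpace H] {I : ModelWithCorners ℂ E' H}
    [TopologicalSpace M] [ChartedSpace H M]
    [NormedAddCommGroup E''] [NormedSpace ℂ E''] [TopologicalSpace H']
    {J : ModelWithCorners ℂ E'' H'} [TopologicalSpace N] [ChartedSpace H' N]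
    [NormedAddCommGroup V] [NormedSpace ℂ V] {U : Opens M} {W : Opens N} {f : U → V} {g : W → V}
    {ψ : M → N} {x₀ : U} {y₀ : W} (hψ : ContMDiffAt I J ω ψ x₀) (h₀ : ψ x₀ = y₀)
    (hg : ContMDiffAt J 𝓘(ℂ, V) ω g y₀)
    (hfg : ∀ᶠ x : U in 𝓝 x₀, ∀ h : ψ x ∈ W, f x = g ⟨ψ x, h⟩) :
    ContMDiffAt I 𝓘(ℂ, V) ω f x₀ := by
  classical
  -- Extension by zero makes the composite with `ψ` total. The value 0 is never met near `x₀`,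
  -- because `W` is an open neighbourhood of `ψ x₀`.
  let G : N → V := fun y => if h : y ∈ W then g ⟨y, h⟩ else 0
  have hG : ContMDiffAt J 𝓘(ℂ, V) ω G (ψ x₀) := by
    rw [h₀, ← contMDiffAt_subtype_iff]
    convert hg using 1
    funext y
    simp [G]
  have hcomp : ContMDiffAt I 𝓘(ℂ, V) ω (fun x : U => G (ψ x)) x₀ :=
    contMDiffAt_subtype_iff.mpr (ContMDiffAt.comp (x₀ : M) hG hψ)
  refine hcomp.congr_of_eventuallyEq ?_
  have hW : ∀ᶠ x : U in 𝓝 x₀, ψ x ∈ W :=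
    (hψ.continuousAt.comp continuous_subtype_val.continuousAt).eventually
      (W.isOpen.mem_nhds (by simp [h₀]))
  filter_upwards [hfg, hW] with x hx hxW
  rw [hx hxW]
  simp [G, hxW]

/-! ### A bundle is determined by its sheaf of sections -/

namespace HolVectorBundle

variable {X : Type} [TopologicalSpace X] [ChartedSpace ℂ X]
variable {Y : Type} [TopologicalSpace Y] [ChartedSpace ℂ Y]

/-- The preferred trivialization of `E` around `x`. -/
abbrev triv (E : HolVectorBundle X) (x : X) : Trivialization E.Model (π E.Model E.Fiber) :=
  trivializationAt E.Model E.Fiber x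

/-- The domain of the preferred trivialization of `E` around `x`. -/
def trivDom (E : HolVectorBundle X) (x : X) : Opens X :=
  ⟨(E.triv x).baseSet, (E.triv x).open_baseSet⟩

theorem mem_trivDom (E : HolVectorBundle X) (x : X) : x ∈ E.trivDom x :=
  mem_baseSet_trivializationAt E.Model E.Fiber x

theorem contMDiffAt_symm (E : HolVectorBundle X) (x₀ : X) {x : X} (hx : x ∈ E.trivDom x₀)
    (v : E.Model) :
    ContMDiffAt 𝓘(ℂ, ℂ) (𝓘(ℂ, ℂ).prod 𝓘(ℂ, E.Model)) ω
      (fun y => TotalSpace.mk' E.Model y ((E.triv x₀).symm y v)) x := by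
  rw [Trivialization.contMDiffAt_section_iff (E.triv x₀) hx]
  refine (contMDiffAt_const (c := v)).congr_of_eventuallyEq ?_
  filter_upwards [(E.trivDom x₀).isOpen.mem_nhds hx] with y hy
  rw [(E.triv x₀).apply_mk_symm hy]

/-- A fibrewise linear map which maps the constant sections of the preferred trivializations to
holomorphic sections is holomorphic. -/
theorem contMDiff_of_frames {E F : HolVectorBundle X} (T : ∀ x, E.Fiber x →ₗ[ℂ] F.Fiber x)
    (hT : ∀ x₀ v, ContMDiffAt 𝓘(ℂ, ℂ) (𝓘(ℂ, ℂ).prod 𝓘(ℂ, F.Model)) ω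
      (fun x => TotalSpace.mk' F.Model x (T x ((E.triv x₀).symm x v))) x₀) :
    ContMDiff (𝓘(ℂ, ℂ).prod 𝓘(ℂ, E.Model)) (𝓘(ℂ, ℂ).prod 𝓘(ℂ, F.Model)) ω
      (fun p : TotalSpace E.Model E.Fiber => TotalSpace.mk' F.Model p.1 (T p.1 p.2)) := by
  intro p₀
  have hid := contMDiffAt_totalSpace.mp
    (contMDiffAt_id (I := 𝓘(ℂ, ℂ).prod 𝓘(ℂ, E.Model)) (n := ω) (x := p₀))
  have hproj : ContMDiffAt (𝓘(ℂ, ℂ).prod 𝓘(ℂ, E.Model)) 𝓘(ℂ, ℂ) ω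
    (fun p : TotalSpace E.Model E.Fiber => p.1) p₀ := hid.1
  refine contMDiffAt_totalSpace.mpr ⟨hproj, ?_⟩
  -- This is `T` read in the trivializations at the base point of `p₀`. For fixed `v`, `L p v`
  -- depends on `p` only through its base point, where it is the coordinate of the section
  -- controlled by `hT`. Off the base sets `L` carries no information, hence the restrictions `hbE`
  -- and `hbF`.
  let L : TotalSpace E.Model E.Fiber → E.Model →ₗ[ℂ] F.Model := fun p =>
    ((F.triv p₀.1).linearMapAt ℂ p.1).comp ((T p.1).comp ((E.triv p₀.1).symmₗ ℂ p.1))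
  have hbE : ∀ᶠ p : TotalSpace E.Model E.Fiber in 𝓝 p₀, p.1 ∈ E.trivDom p₀.1 :=
    hproj.continuousAt.eventually ((E.trivDom p₀.1).isOpen.mem_nhds (E.mem_trivDom _))
  have hbF : ∀ᶠ p : TotalSpace E.Model E.Fiber in 𝓝 p₀, p.1 ∈ F.trivDom p₀.1 :=
    hproj.continuousAt.eventually ((F.trivDom p₀.1).isOpen.mem_nhds (F.mem_trivDom _))
  have hL : ∀ v, ContMDiffAt (𝓘(ℂ, ℂ).prod 𝓘(ℂ, E.Model)) 𝓘(ℂ, F.Model) ω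
      (fun p => L p v) p₀ := by
    intro v
    have h1 := (contMDiffAt_section p₀.1).mp (hT p₀.1 v)
    refine (ContMDiffAt.comp p₀ h1 hproj).congr_of_eventuallyEq ?_
    filter_upwards [hbE, hbF] with p hpE hp
    simp only [L, LinearMap.comp_apply]
    rw [Trivialization.coe_linearMapAt_of_mem _ hp]
    beta_reduce
    rw [Trivialization.symmₗ_apply (R := ℂ) _ hpE]
    rfl
  refine (contMDiffAt_linearMap_apply L hL hid.2).congr_of_eventuallyEq ?_
  filter_upwards [hbE, hbF] with p hpE hpF
  simp only [L, LinearMap.comp_apply]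
  rw [Trivialization.coe_linearMapAt_of_mem _ hpF]
  beta_reduce
  rw [Trivialization.symmₗ_apply (R := ℂ) _ hpE]
  change _ = ((F.triv p₀.1) ⟨p.1, T p.1 ((E.triv p₀.1).symm p.1 (E.triv p₀.1 ⟨p.1, p.2⟩).2)⟩).2
  rw [(E.triv p₀.1).symm_apply_apply_mk hpE]

/-- The section of `E` with constant coordinate `v` in the preferred trivialization. -/
def frame (E : HolVectorBundle X) (x₀ : X) (v : E.Model) : Sec E (E.trivDom x₀) :=
  ⟨fun x => (E.triv x₀).symm x v, fun x =>
    contMDiffAt_subtype_iff.mpr (E.contMDiffAt_symm x₀ x.2 v)⟩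

/-- The constant function. -/
def HolFun.const (U : Opens X) (c : ℂ) : HolFun U := ⟨fun _ => c, contMDiff_const⟩

/-- Replacing `symm` by the bundled linear map `symmₗ` lets linearity of frames in `v` follow from
`map_add` and `map_smul`. -/
theorem frame_apply (E : HolVectorBundle X) (x₀ : X) (v : E.Model) (x : E.trivDom x₀) :
    (E.frame x₀ v).1 x = (E.triv x₀).symmₗ ℂ (x : X) v :=
  ((E.triv x₀).symmₗ_apply (R := ℂ) x.2 v).symm

theorem frame_add (E : HolVectorBundle X) (x₀ : X) (v w : E.Model) :
    E.frame x₀ (v + w) = E.frame x₀ v + E.frame x₀ w :=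
  Subtype.ext (funext fun x => by
    change _ = (E.frame x₀ v).1 x + (E.frame x₀ w).1 x
    simp only [frame_apply, map_add])

theorem frame_smul (E : HolVectorBundle X) (x₀ : X) (c : ℂ) (v : E.Model) :
    E.frame x₀ (c • v) = (HolFun.const (E.trivDom x₀) c) • E.frame x₀ v :=
  Subtype.ext (funext fun x => by
    change _ = c • (E.frame x₀ v).1 x
    simp only [frame_apply, map_smul])

/-- The value of a section at a point, as an additive map. -/
def evalAt (E : HolVectorBundle X) {U : Opens X} (x : U) : Sec E U →+ E.Fiber x where
  toFun s := s.1 x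
  map_zero' := rfl
  map_add' _ _ := rfl

/-- Restriction of sections. -/
def secRes (E : HolVectorBundle X) {U V : Opens X} (h : V ≤ U) : Sec E U →+ Sec E V :=
  E.sheafOfSections.res h

/-- A morphism between the sheaves of sections of two bundles. -/
structure SecHom (E F : HolVectorBundle X) where
  app : ∀ U : Opens X, Sec E U →ₗ[HolFun U] Sec F U
  naturality : ∀ {U V : Opens X} (h : V ≤ U) (s : Sec E U),
    app V (E.secRes h s) = F.secRes h (app U s)

namespace SecHom

variable {E F : HolVectorBundle X}

/-- The linear map between the fibres induced by a morphism of sheaves of sections. -/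
def fiberMap (φ : SecHom E F) (x : X) : E.Fiber x →ₗ[ℂ] F.Fiber x where
  -- The vector `w` is extended to a section with constant coordinate, and the image of that section
  -- is evaluated at `x`. That any other extension would do is `fiberMap_apply`.
  toFun w := (φ.app _ (E.frame x ((E.triv x).linearMapAt ℂ x w))).1 ⟨x, E.mem_trivDom x⟩
  map_add' v w := by rw [map_add, frame_add, map_add]; rfl
  map_smul' c w := by rw [map_smul, frame_smul, map_smul]; rfl

/-- The value of a section under a morphism of sheaves depends only on its value. -/
theorem fiberMap_apply (φ : SecHom E F) {U : Opens X} (s : Sec E U) (x : U) :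
    φ.fiberMap x (s.1 x) = (φ.app U s).1 x := by
  let b := Module.finBasis ℂ E.Model
  let W : Opens X := U ⊓ E.trivDom x
  have hWU : W ≤ U := inf_le_left
  have hWE : W ≤ E.trivDom x := inf_le_right
  let f : ∀ i, HolFun W := fun i => ⟨fun y => b.coord i (((E.triv x) ⟨y, s.1 ⟨y, hWU y.2⟩⟩).2), by
    intro y
    have h1 := (Trivialization.contMDiffAt_iff (IB := 𝓘(ℂ, ℂ)) (n := ω) (e := E.triv x)
      (f := fun z : W => TotalSpace.mk' E.Model (z : X) (s.1 ⟨z, hWU z.2⟩)) (x₀ := y)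
      ((E.triv x).mem_source.mpr (hWE y.2))).mp ((E.secRes hWU s).2 y)
    exact (LinearMap.toContinuousLinearMap (b.coord i)).contMDiff.contMDiffAt.comp y h1.2⟩
  -- On `W` the section is a combination of the frame with holomorphic coefficients. By 𝒪-linearity
  -- its image is the same combination of the images of the frame, and at `x` only the numbers `f i
  -- x` survive.
  have hs : (E.secRes hWU s) =
      ∑ i, f i • E.secRes hWE (E.frame x (b i)) := by
    refine Subtype.ext (funext fun y => ?_)
    change _ = E.evalAt y _
    rw [map_sum]
    change s.1 ⟨y, hWU y.2⟩ = ∑ i, f i y • (E.frame x (b i)).1 ⟨y, hWE y.2⟩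
    simp only [frame_apply, ← map_smul, ← map_sum]
    change _ = (E.triv x).symmₗ ℂ (y : X)
      (∑ i, b.repr ((E.triv x) ⟨y, s.1 ⟨y, hWU y.2⟩⟩).2 i • b i)
    rw [b.sum_repr, Trivialization.symmₗ_apply (R := ℂ) _ (hWE y.2),
      (E.triv x).symm_apply_apply_mk (hWE y.2)]
  let xW : W := ⟨x, x.2, E.mem_trivDom x⟩
  have h1 := congrArg (F.evalAt xW) (congrArg (φ.app W) hs)
  rw [φ.naturality, map_sum, map_sum] at h1
  change (φ.app U s).1 x = ∑ i, F.evalAt xW (φ.app W (f i • _)) at h1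
  rw [h1]
  have h2 : s.1 x = ∑ i, f i xW • (E.frame x (b i)).1 ⟨x, E.mem_trivDom x⟩ := by
    have := congrArg (E.evalAt xW) hs
    rwa [map_sum] at this
  rw [h2, map_sum]
  refine Finset.sum_congr rfl fun i _ => ?_
  rw [map_smul, map_smul, φ.naturality]
  change _ = f i xW • (φ.app _ (E.frame x (b i))).1 ⟨x, E.mem_trivDom x⟩
  congr 1
  change (φ.app _ (E.frame x _)).1 ⟨x, E.mem_trivDom x⟩ = _
  -- At `x` the frame section has coordinate `b i`, so the extension chosen in `fiberMap` is this
  -- frame section itself.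
  rw [frame_apply, Trivialization.linearMapAt_symmₗ _ (E.mem_trivDom x)]

/-- By `fiberMap_apply` the pointwise image of a frame section is its image under `φ`, which is a
holomorphic section; the frame criterion `contMDiff_of_frames` needs nothing more. -/
theorem contMDiff_fiberMap (φ : SecHom E F) :
    ContMDiff (𝓘(ℂ, ℂ).prod 𝓘(ℂ, E.Model)) (𝓘(ℂ, ℂ).prod 𝓘(ℂ, F.Model)) ω
      (fun p : TotalSpace E.Model E.Fiber => TotalSpace.mk' F.Model p.1 (φ.fiberMap p.1 p.2)) := by
  refine contMDiff_of_frames _ fun x₀ v => ?_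
  have h := (φ.app _ (E.frame x₀ v)).2 ⟨x₀, E.mem_trivDom x₀⟩
  refine (contMDiffAt_subtype_iff (U := E.trivDom x₀) (x := ⟨x₀, E.mem_trivDom x₀⟩)).mp ?_
  convert h using 1
  funext x
  rw [← fiberMap_apply]
  rfl

/-- The chosen extension of `w` is returned by `ψ ∘ φ`, and `fiberMap_apply` lets `ψ` be evaluated
on the image section although that section is not a frame. -/
theorem fiberMap_fiberMap (φ : SecHom E F) (ψ : SecHom F E)
    (h : ∀ U s, ψ.app U (φ.app U s) = s) (x : X) (w : E.Fiber x) :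
    ψ.fiberMap x (φ.fiberMap x w) = w := by
  change ψ.fiberMap x ((φ.app _ (E.frame x _)).1 ⟨x, E.mem_trivDom x⟩) = w
  rw [ψ.fiberMap_apply (U := E.trivDom x) _ ⟨x, E.mem_trivDom x⟩, h, frame_apply,
    Trivialization.symmₗ_linearMapAt _ (E.mem_trivDom x)]

end SecHom

/-- Bundles with isomorphic sheaves of sections are isomorphic. -/
theorem isIsomorphic_of_iso {E F : HolVectorBundle X}
    (φ : OModule.Iso E.sheafOfSections F.sheafOfSections) : E.IsIsomorphic F := by
  let a : SecHom E F := ⟨fun U => (φ.toEquiv U).toLinearMap, fun h s => φ.naturality h s⟩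
  let b : SecHom F E := ⟨fun U => (φ.toEquiv U).symm.toLinearMap, fun {U V} h s => by
    change (φ.toEquiv V).symm (F.sheafOfSections.res h s) =
      E.sheafOfSections.res h ((φ.toEquiv U).symm s)
    rw [LinearEquiv.symm_apply_eq, φ.naturality]
    exact congrArg _ ((φ.toEquiv U).apply_symm_apply s).symm⟩
  have hab : ∀ U s, b.app U (a.app U s) = s := fun U s => (φ.toEquiv U).symm_apply_apply s
  have hba : ∀ U s, a.app U (b.app U s) = s := fun U s => (φ.toEquiv U).apply_symm_apply s
  exact ⟨{
    toEquiv := fun x => LinearEquiv.ofLinearMap (a.fiberMap x) (b.fiberMap x)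
      (LinearMap.ext (b.fiberMap_fiberMap a hba x)) (LinearMap.ext (a.fiberMap_fiberMap b hab x))
    contMDiff_toEquiv := a.contMDiff_fiberMap
    contMDiff_symm := b.contMDiff_fiberMap }⟩

/-- Isomorphic bundles have isomorphic sheaves of sections. -/
def Iso.secIso {E F : HolVectorBundle X} (T : Iso E F) :
    OModule.Iso E.sheafOfSections F.sheafOfSections where
  toEquiv U :=
    { toFun := fun s : Sec E U => (⟨fun x => T.toEquiv x (s.1 x),
        T.contMDiff_toEquiv.comp s.2⟩ : Sec F U)
      invFun := fun s : Sec F U => (⟨fun x => (T.toEquiv x).symm (s.1 x),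
        T.contMDiff_symm.comp s.2⟩ : Sec E U)
      map_add' := fun _ _ => Subtype.ext (funext fun x => (T.toEquiv x).map_add _ _)
      map_smul' := fun _ _ => Subtype.ext (funext fun x => (T.toEquiv x).map_smul _ _)
      left_inv := fun _ => Subtype.ext (funext fun x => (T.toEquiv x).symm_apply_apply _)
      right_inv := fun _ => Subtype.ext (funext fun x => (T.toEquiv x).apply_symm_apply _) }
  naturality _ _ := rfl

/-- Coordinates in the pulled-back trivialization are by definition those of `E` at `φ y₀`; the two
inverses agree as inverses of the same map. -/
theorem pullback_triv_symm (E : HolVectorBundle X) (φ : C^ω⟮𝓘(ℂ, ℂ), Y; 𝓘(ℂ, ℂ), X⟯) {y₀ y : Y}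
    (hy : φ y ∈ E.trivDom (φ y₀)) (v : E.Model) :
    ((E.pullback φ).triv y₀).symm y v = (E.triv (φ y₀)).symm (φ y) v := by
  have h := ((E.pullback φ).triv y₀).symm_apply_apply_mk (b := y) hy
    ((E.triv (φ y₀)).symm (φ y) v : E.Fiber (φ y))
  have h2 : (((E.pullback φ).triv y₀) ⟨y, ((E.triv (φ y₀)).symm (φ y) v : E.Fiber (φ y))⟩).2 =
      v := congrArg Prod.snd ((E.triv (φ y₀)).apply_mk_symm hy v)
  rwa [h2] at h

/-- This is the hypothesis of `contMDiff_of_frames` for the pullback of `T`. The section obtained by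
applying `T` to a frame is composed with `φ`. -/
theorem contMDiffAt_frame_pullback {E F : HolVectorBundle X} (φ : C^ω⟮𝓘(ℂ, ℂ), Y; 𝓘(ℂ, ℂ), X⟯)
    (T : ∀ x, E.Fiber x →ₗ[ℂ] F.Fiber x)
    (hT : ContMDiff (𝓘(ℂ, ℂ).prod 𝓘(ℂ, E.Model)) (𝓘(ℂ, ℂ).prod 𝓘(ℂ, F.Model)) ω
      (fun p : TotalSpace E.Model E.Fiber => TotalSpace.mk' F.Model p.1 (T p.1 p.2)))
    (y₀ : Y) (v : E.Model) :
    ContMDiffAt 𝓘(ℂ, ℂ) 𝓘(ℂ, F.Model) ω (fun y : Y =>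
      (F.triv (φ y₀) ⟨φ y, T (φ y) (((E.pullback φ).triv y₀).symm y v)⟩).2) y₀ := by
  have h1 : ContMDiffAt 𝓘(ℂ, ℂ) (𝓘(ℂ, ℂ).prod 𝓘(ℂ, F.Model)) ω
      (fun y : Y => TotalSpace.mk' F.Model (φ y) (T (φ y) ((E.triv (φ y₀)).symm (φ y) v))) y₀ :=
    (hT.contMDiffAt.comp (φ y₀) (E.contMDiffAt_symm (φ y₀) (E.mem_trivDom _) v)).comp y₀
      φ.contMDiff.contMDiffAt
  refine (contMDiffAt_totalSpace.mp h1).2.congr_of_eventuallyEq ?_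
  filter_upwards [φ.contMDiff.continuous.continuousAt.eventually
    ((E.trivDom (φ y₀)).isOpen.mem_nhds (E.mem_trivDom _))] with y hy
  rw [E.pullback_triv_symm φ hy]

/-- The pullback of an isomorphism. -/
theorem IsIsomorphic.pullback {E F : HolVectorBundle X} (h : E.IsIsomorphic F)
    (φ : C^ω⟮𝓘(ℂ, ℂ), Y; 𝓘(ℂ, ℂ), X⟯) : (E.pullback φ).IsIsomorphic (F.pullback φ) := by
  obtain ⟨T⟩ := h
  exact ⟨{
    toEquiv := fun y => T.toEquiv (φ y)
    contMDiff_toEquiv := contMDiff_of_frames (E := E.pullback φ) (F := F.pullback φ)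
      (fun y => (T.toEquiv (φ y)).toLinearMap) fun y₀ v => (contMDiffAt_section y₀).mpr
        (contMDiffAt_frame_pullback φ (fun x => (T.toEquiv x).toLinearMap)
          T.contMDiff_toEquiv y₀ v)
    contMDiff_symm := contMDiff_of_frames (E := F.pullback φ) (F := E.pullback φ)
      (fun y => (T.toEquiv (φ y)).symm.toLinearMap) fun y₀ v => (contMDiffAt_section y₀).mpr
        (contMDiffAt_frame_pullback φ (fun x => (T.toEquiv x).symm.toLinearMap)
          T.contMDiff_symm y₀ v) }⟩

/-- Composition of isomorphisms of sheaves of modules. -/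
def OModule.Iso.trans {M N P : OModule X}
    (a : OModule.Iso M N) (b : OModule.Iso N P) : OModule.Iso M P where
  toEquiv U := (a.toEquiv U).trans (b.toEquiv U)
  naturality h s := by
    simp only [LinearEquiv.trans_apply, a.naturality, b.naturality]

/-- The inverse of an isomorphism of sheaves of modules. -/
def OModule.Iso.symm {M N : OModule X}
    (a : OModule.Iso M N) : OModule.Iso N M where
  toEquiv U := (a.toEquiv U).symm
  naturality h s := by
    rw [LinearEquiv.symm_apply_eq, a.naturality, LinearEquiv.apply_symm_apply]

/-- The direct image of an isomorphism of sheaves of modules. -/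
def OModule.Iso.directImage (φ : C^ω⟮𝓘(ℂ, ℂ), Y; 𝓘(ℂ, ℂ), X⟯) {M N : OModule Y}
    (a : OModule.Iso M N) : OModule.Iso (M.directImage φ) (N.directImage φ) where
  toEquiv U :=
    { toFun := a.toEquiv (U.comap (φ : C(Y, X)))
      invFun := (a.toEquiv (U.comap (φ : C(Y, X)))).symm
      map_add' := map_add (a.toEquiv (U.comap (φ : C(Y, X))))
      map_smul' := fun f => (a.toEquiv (U.comap (φ : C(Y, X)))).map_smul (HolFun.comap φ U f)
      left_inv := (a.toEquiv _).symm_apply_apply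
      right_inv := (a.toEquiv _).apply_symm_apply }
  naturality _ s := a.naturality _ s

end HolVectorBundle

/-! ### Equivariant functions on ℂ -/

open Matrix HolVectorBundle

/-- The projection `p_τ : ℂ → E_τ` as a holomorphic map. -/
def projMap (τ : ℍ) : C^ω⟮𝓘(ℂ, ℂ), ℂ; 𝓘(ℂ, ℂ), Torus τ⟯ := ⟨proj τ, contMDiff_proj τ⟩

/-- The open set `p_τ⁻¹(U)`. -/
def pre {τ : ℍ} (U : Opens (Torus τ)) : Opens ℂ := U.comap (projMap τ : C(ℂ, Torus τ))

/-- The map `p_τ⁻¹(U) → U`. -/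
def preProj {τ : ℍ} {U : Opens (Torus τ)} (z : pre U) : U := ⟨proj τ z, z.2⟩

theorem contMDiff_preProj {τ : ℍ} (U : Opens (Torus τ)) :
    ContMDiff 𝓘(ℂ, ℂ) 𝓘(ℂ, ℂ) ω (preProj : pre U → U) :=
  contMDiff_restrictPreimage (projMap τ) U

/-- A point of the fibre of `p_τ` over a point of `U`, as a point of `p_τ⁻¹(U)`. -/
def preMk {τ : ℍ} {U : Opens (Torus τ)} {x : Torus τ} (hx : x ∈ U) (z : {z : ℂ // proj τ z = x}) :
    pre U := ⟨z, show proj τ z ∈ U from z.2.symm ▸ hx⟩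

theorem proj_add_one {τ : ℍ} (z : ℂ) : proj τ (z + 1) = proj τ z :=
  (proj_eq_iff.mpr ⟨0, 1, by simp⟩).symm

theorem proj_add_tau {τ : ℍ} (z : ℂ) : proj τ (z + τ) = proj τ z :=
  (proj_eq_iff.mpr ⟨1, 0, by simp⟩).symm

theorem localInv_proj (τ : ℍ) (z : ℂ) : localInv τ z (proj τ z) = z := by
  have := (localInv τ z).right_inv (isLocalHomeomorph_proj τ).self_mem_localInverseAt_target
  rwa [localInv_symm] at this

theorem contMDiffAt_localInv (τ : ℍ) {z : ℂ} {x : Torus τ} (hx : x ∈ (localInv τ z).source) :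
    ContMDiffAt 𝓘(ℂ, ℂ) 𝓘(ℂ, ℂ) ω (localInv τ z) x :=
  (contMDiffOn_localInv τ z).contMDiffAt ((localInv τ z).open_source.mem_nhds hx)

/-- A property invariant under `z ↦ z + 1` and `z ↦ z + τ` is a property of the image in `E_τ`. -/
theorem lattice_invariant {τ : ℍ} {P : ℂ → Prop} (h1 : ∀ z, P (z + 1) ↔ P z)
    (hτ : ∀ z, P (z + τ) ↔ P z) {z w : ℂ} (h : proj τ z = proj τ w) : P z ↔ P w := by
  have key : ∀ c : ℂ, (∀ z, P (z + c) ↔ P z) → ∀ (m : ℤ) z, P (z + m * c) ↔ P z := by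
    intro c hc m
    induction m using Int.induction_on with
    | zero => simp
    | succ m ih =>
      intro z
      have e : z + ((m + 1 : ℤ) : ℂ) * c = z + (m : ℤ) * c + c := by
        push_cast
        ring
      rw [e, hc, ih]
    | pred m ih =>
      intro z
      have e : z + ((-m - 1 : ℤ) : ℂ) * c + c = z + (-m : ℤ) * c := by
        push_cast
        ring
      rw [← hc, e, ih]
  obtain ⟨m, n, hmn⟩ := proj_eq_iff.mp h
  have hw : w = z + m * τ + n * 1 := by
    rw [eq_add_of_sub_eq hmn]
    ring
  rw [hw, key 1 h1, key τ hτ]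

section AutoSheaf

variable {ι : Type} [Fintype ι]

/-- The holomorphic functions `g : p_τ⁻¹(U) → ℂ^ι` with `g(z + 1) = g(z)` and
`g(z + τ) = B(z) g(z)`. -/
def autoSubmonoid (τ : ℍ) (B : ℂ → Matrix ι ι ℂ) (U : Opens (Torus τ)) :
    AddSubmonoid (pre U → ι → ℂ) where
  carrier := {g | ContMDiff 𝓘(ℂ, ℂ) 𝓘(ℂ, ι → ℂ) ω g ∧
    (∀ z z' : pre U, (z' : ℂ) = z + 1 → g z' = g z) ∧
    ∀ z z' : pre U, (z' : ℂ) = z + τ → g z' = B z *ᵥ g z}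
  zero_mem' := ⟨contMDiff_const, fun _ _ _ => rfl, fun _ _ _ => by simp⟩
  add_mem' := by
    rintro g h ⟨hg, hg1, hgτ⟩ ⟨hh, hh1, hhτ⟩
    refine ⟨hg.add hh, fun z z' hz => ?_, fun z z' hz => ?_⟩
    · simp [hg1 z z' hz, hh1 z z' hz]
    · simp [hgτ z z' hz, hhτ z z' hz, mulVec_add]

/-- The space of sections over `U` of the sheaf of equivariant functions. -/
abbrev AutoSec (τ : ℍ) (B : ℂ → Matrix ι ι ℂ) (U : Opens (Torus τ)) : Type :=
  autoSubmonoid τ B U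

variable {τ : ℍ} {B : ℂ → Matrix ι ι ℂ}

theorem preProj_eq_of_add_one {U : Opens (Torus τ)} {z z' : pre U} (h : (z' : ℂ) = z + 1) :
    preProj z' = preProj z :=
  Subtype.ext (by simp only [preProj, h, proj_add_one])

theorem preProj_eq_of_add_tau {U : Opens (Torus τ)} {z z' : pre U} (h : (z' : ℂ) = z + τ) :
    preProj z' = preProj z :=
  Subtype.ext (by simp only [preProj, h, proj_add_tau])

instance (U : Opens (Torus τ)) : SMul (HolFun U) (AutoSec τ B U) where
  smul f g := ⟨fun z => f (preProj z) • g.1 z,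
    (f.contMDiff.comp (contMDiff_preProj U)).smul g.2.1,
    fun z z' h => by beta_reduce; rw [preProj_eq_of_add_one h, g.2.2.1 z z' h],
    fun z z' h => by beta_reduce; rw [preProj_eq_of_add_tau h, g.2.2.2 z z' h, mulVec_smul]⟩

instance (U : Opens (Torus τ)) : Module (HolFun U) (AutoSec τ B U) where
  one_smul g := Subtype.ext (funext fun z => one_smul ℂ (g.1 z))
  mul_smul f f' g := Subtype.ext (funext fun z => mul_smul (f (preProj z)) (f' (preProj z)) (g.1 z))
  smul_zero f := Subtype.ext (funext fun z => smul_zero (f (preProj z)))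
  smul_add f g h := Subtype.ext (funext fun z => smul_add (f (preProj z)) (g.1 z) (h.1 z))
  add_smul f f' g := Subtype.ext (funext fun z => add_smul (f (preProj z)) (f' (preProj z)) (g.1 z))
  zero_smul g := Subtype.ext (funext fun z => zero_smul ℂ (g.1 z))

/-- The sheaf of equivariant functions. -/
def autoSheaf (τ : ℍ) (B : ℂ → Matrix ι ι ℂ) : OModule (Torus τ) where
  obj := AutoSec τ B
  res h :=
    { toFun := fun g => ⟨fun z => g.1 ⟨z, h z.2⟩,
        g.2.1.comp (contMDiff_inclusion (Opens.comap_mono _ h)),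
        fun z z' hz => g.2.2.1 ⟨z, h z.2⟩ ⟨z', h z'.2⟩ hz,
        fun z z' hz => g.2.2.2 ⟨z, h z.2⟩ ⟨z', h z'.2⟩ hz⟩
      map_zero' := rfl
      map_add' := fun _ _ => rfl }
  res_smul _ _ _ := rfl
  res_refl _ _ := rfl
  res_res _ _ _ := rfl

end AutoSheaf

/-! ### Trivializations over ℂ and their multipliers -/

/-- A holomorphic trivialization of the pullback of `E` to `ℂ`. -/
structure Unif {τ : ℍ} (E : HolVectorBundle (Torus τ)) (ι : Type) [Fintype ι] where
  ev : ∀ {x : Torus τ}, {z : ℂ // proj τ z = x} → E.Fiber x ≃ₗ[ℂ] (ι → ℂ)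
  hol : ∀ (z₀ : ℂ) (v : E.Model), ContMDiffAt 𝓘(ℂ, ℂ) 𝓘(ℂ, ι → ℂ) ω
    (fun z => ev ⟨z, rfl⟩ ((E.triv (proj τ z₀)).symm (proj τ z) v)) z₀
  hol_symm : ∀ (z₀ : ℂ) (v : ι → ℂ), ContMDiffAt 𝓘(ℂ, ℂ) 𝓘(ℂ, E.Model) ω
    (fun z => (E.triv (proj τ z₀) ⟨proj τ z, (ev ⟨z, rfl⟩).symm v⟩).2) z₀

namespace Unif

variable {τ : ℍ} {E E' : HolVectorBundle (Torus τ)} {ι : Type} [Fintype ι]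

/-- The trivialization `u` of the pullback of `E` to `ℂ` changes by `1` under `z ↦ z + 1` and by
`B(z)` under `z ↦ z + τ`. -/
structure IsMultiplier (u : Unif E ι) (B : ℂ → Matrix ι ι ℂ) : Prop where
  add_one : ∀ {x : Torus τ} (z z' : {z : ℂ // proj τ z = x}) (w : E.Fiber x),
    (z' : ℂ) = z + 1 → u.ev z' w = u.ev z w
  add_tau : ∀ {x : Torus τ} (z z' : {z : ℂ // proj τ z = x}) (w : E.Fiber x),
    (z' : ℂ) = z + τ → u.ev z' w = B z *ᵥ u.ev z w

variable {u : Unif E ι} {B : ℂ → Matrix ι ι ℂ}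

/-- The matrix `B z` is the change between the two coordinate isomorphisms of one fibre, at z and at
z + τ, hence invertible even though `B` is only assumed matrix-valued. -/
theorem IsMultiplier.mulVec_injective (hB : u.IsMultiplier B) (z : ℂ) :
    Function.Injective (B z).mulVec := by
  intro a b hab
  have h : ∀ v, B z *ᵥ v = u.ev ⟨z + τ, proj_add_tau z⟩ ((u.ev ⟨z, rfl⟩).symm v) := by
    intro v
    rw [hB.add_tau ⟨z, rfl⟩ ⟨z + τ, proj_add_tau z⟩ _ rfl, LinearEquiv.apply_symm_apply]
  simpa [h] using hab

/-- If a vector in a fibre corresponds to an equivariant function at one point, then it does so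
at all points. -/
theorem IsMultiplier.ev_eq_of_ev_eq (hB : u.IsMultiplier B) {U : Opens (Torus τ)}
    (g : AutoSec τ B U) {x : Torus τ} (hx : x ∈ U) (w : E.Fiber x)
    (z z' : {z : ℂ // proj τ z = x})
    (h : u.ev z w = g.1 (preMk hx z)) :
    u.ev z' w = g.1 (preMk hx z') := by
  -- Quantifying over the proof that z lies over `x` makes `P` a predicate on all of ℂ, to which
  -- `lattice_invariant` applies.
  let P : ℂ → Prop := fun z => ∀ hz : proj τ z = x,
    u.ev ⟨z, hz⟩ w = g.1 (preMk hx ⟨z, hz⟩)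
  have h1 : ∀ z, P (z + 1) ↔ P z := fun z => by
    have e : ∀ (hz : proj τ z = x) (hz' : proj τ (z + 1) = x),
        (u.ev ⟨z + 1, hz'⟩ w = g.1 (preMk hx ⟨z + 1, hz'⟩)) ↔
        (u.ev ⟨z, hz⟩ w = g.1 (preMk hx ⟨z, hz⟩)) := fun hz hz' => by
      rw [hB.add_one ⟨z, hz⟩ ⟨z + 1, hz'⟩ w rfl,
        g.2.2.1 (preMk hx ⟨z, hz⟩) (preMk hx ⟨z + 1, hz'⟩) rfl]
    exact ⟨fun H hz => (e hz ((proj_add_one z).trans hz)).mp (H _),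
      fun H hz' => (e ((proj_add_one z).symm.trans hz') hz').mpr (H _)⟩
  have hτ : ∀ z, P (z + τ) ↔ P z := fun z => by
    have e : ∀ (hz : proj τ z = x) (hz' : proj τ (z + τ) = x),
        (u.ev ⟨z + τ, hz'⟩ w = g.1 (preMk hx ⟨z + τ, hz'⟩)) ↔
        (u.ev ⟨z, hz⟩ w = g.1 (preMk hx ⟨z, hz⟩)) := fun hz hz' => by
      rw [hB.add_tau ⟨z, hz⟩ ⟨z + τ, hz'⟩ w rfl,
        g.2.2.2 (preMk hx ⟨z, hz⟩) (preMk hx ⟨z + τ, hz'⟩) rfl]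
      -- Injectivity gives the backward direction, from z + τ to z.
      exact (hB.mulVec_injective z).eq_iff
    exact ⟨fun H hz => (e hz ((proj_add_tau z).trans hz)).mp (H _),
      fun H hz' => (e ((proj_add_tau z).symm.trans hz') hz').mpr (H _)⟩
  exact (lattice_invariant h1 hτ (z.2.trans z'.2.symm)).mp (fun _ => h) z'.2

/-- The function on `p_τ⁻¹(U)` which describes a section is holomorphic. -/
theorem contMDiff_ev (u : Unif E ι) {U : Opens (Torus τ)} (s : Sec E U) :
    ContMDiff 𝓘(ℂ, ℂ) 𝓘(ℂ, ι → ℂ) ω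
      (fun z : pre U => u.ev ⟨z, rfl⟩ (s.1 (preProj z))) := by
  intro z₀
  -- In the trivialization at `proj τ z₀` the coordinates of `s` are holomorphic, and passing from
  -- them to the coordinates of `u` is a holomorphic family by `u.hol`.
  let L : pre U → E.Model →ₗ[ℂ] (ι → ℂ) := fun z =>
    (u.ev ⟨z, rfl⟩).toLinearMap.comp ((E.triv (proj τ z₀)).symmₗ ℂ (proj τ z))
  have hmem : ∀ᶠ z : pre U in 𝓝 z₀, proj τ z ∈ E.trivDom (proj τ z₀) :=
    ((contMDiff_proj τ).continuous.comp continuous_subtype_val).continuousAt.eventually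
      ((E.trivDom _).isOpen.mem_nhds (E.mem_trivDom _))
  have hL : ∀ v, ContMDiffAt 𝓘(ℂ, ℂ) 𝓘(ℂ, ι → ℂ) ω (fun z => L z v) z₀ := by
    intro v
    refine (contMDiffAt_subtype_iff.mpr (u.hol z₀ v)).congr_of_eventuallyEq ?_
    filter_upwards [hmem] with z hz
    simp only [L, LinearMap.comp_apply]
    rw [Trivialization.symmₗ_apply (R := ℂ) _ hz]
    rfl
  have hs := ((contMDiffAt_section_iff E s.1 (preProj z₀)).mp (s.2 _)).comp z₀
    (contMDiff_preProj U).contMDiffAt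
  refine (contMDiffAt_linearMap_apply L hL hs).congr_of_eventuallyEq ?_
  filter_upwards [hmem] with z hz
  simp only [L, LinearMap.comp_apply]
  rw [Trivialization.symmₗ_apply (R := ℂ) _ hz]
  exact congrArg (u.ev ⟨z, rfl⟩) ((E.triv (proj τ z₀)).symm_apply_apply_mk hz _).symm

/-- A section is holomorphic if the function on `p_τ⁻¹(U)` which describes it is. -/
theorem contMDiff_of_ev (u : Unif E ι) {U : Opens (Torus τ)} (s : ∀ x : U, E.Fiber x)
    (hs : ContMDiff 𝓘(ℂ, ℂ) 𝓘(ℂ, ι → ℂ) ω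
      (fun z : pre U => u.ev ⟨z, rfl⟩ (s (preProj z)))) :
    ContMDiff 𝓘(ℂ, ℂ) (𝓘(ℂ, ℂ).prod 𝓘(ℂ, E.Model)) ω
      (fun x : U => TotalSpace.mk' E.Model (x : Torus τ) (s x)) := by
  rintro ⟨x₀, hx₀⟩
  obtain ⟨z₀, rfl⟩ := proj_surjective τ x₀
  rw [contMDiffAt_section_iff]
  let z₁ : pre U := ⟨z₀, hx₀⟩
  let L : pre U → (ι → ℂ) →ₗ[ℂ] E.Model := fun z =>
    ((E.triv (proj τ z₀)).linearMapAt ℂ (proj τ z)).comp (u.ev ⟨z, rfl⟩).symm.toLinearMap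
  have hmem : ∀ᶠ z : pre U in 𝓝 z₁, proj τ z ∈ E.trivDom (proj τ z₀) :=
    ((contMDiff_proj τ).continuous.comp continuous_subtype_val).continuousAt.eventually
      ((E.trivDom _).isOpen.mem_nhds (E.mem_trivDom _))
  have hL : ∀ v, ContMDiffAt 𝓘(ℂ, ℂ) 𝓘(ℂ, E.Model) ω (fun z => L z v) z₁ := by
    intro v
    refine (contMDiffAt_subtype_iff (U := pre U) (x := z₁) |>.mpr
      (u.hol_symm z₀ v)).congr_of_eventuallyEq ?_
    filter_upwards [hmem] with z hz
    simp only [L, LinearMap.comp_apply]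
    rw [Trivialization.coe_linearMapAt_of_mem _ hz]
    rfl
  have hg : ContMDiffAt 𝓘(ℂ, ℂ) 𝓘(ℂ, E.Model) ω
      (fun z : pre U => (E.triv (proj τ z₀) ⟨proj τ z, s (preProj z)⟩).2) z₁ := by
    refine (contMDiffAt_linearMap_apply L hL (hs z₁)).congr_of_eventuallyEq ?_
    filter_upwards [hmem] with z hz
    simp only [L, LinearMap.comp_apply]
    rw [Trivialization.coe_linearMapAt_of_mem _ hz]
    exact congrArg (fun w : E.Fiber (proj τ z) => (E.triv (proj τ z₀) ⟨proj τ z, w⟩).2)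
      ((u.ev ⟨z, rfl⟩).symm_apply_apply (s (preProj z))).symm
  have h0 : proj τ z₀ ∈ (localInv τ z₀).source := mem_localInv_source τ z₀
  -- By `hg` the coordinates of `s` are holomorphic upstairs; composition with the local inverse of
  -- the projection at `z₀` brings this down to the torus.
  refine contMDiffAt_of_eventuallyEq_comp (contMDiffAt_localInv τ h0) (localInv_proj τ z₀) hg ?_
  filter_upwards [continuous_subtype_val.continuousAt.eventually
    ((localInv τ z₀).open_source.mem_nhds h0)] with x hx h
  have hxe : x = preProj ⟨localInv τ z₀ x, h⟩ := Subtype.ext (proj_localInv hx).symm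
  exact congrArg (fun y : U => (E.triv (proj τ z₀) ⟨y, s y⟩).2) hxe

/-- The fibres over `preProj z` and over `x` are only propositionally equal; substituting for `x`
moves between them. -/
theorem ev_preProj (u : Unif E ι) {U : Opens (Torus τ)} (s : ∀ x : U, E.Fiber x)
    (z : pre U) {x : U}
    (h : proj τ z = x) : u.ev ⟨z, rfl⟩ (s (preProj z)) = u.ev ⟨z, h⟩ (s x) := by
  obtain rfl : preProj z = x := Subtype.ext h
  rfl

/-- The section described by an equivariant function. -/
def glue (u : Unif E ι) {U : Opens (Torus τ)} (g : AutoSec τ B U) (x : U) : E.Fiber x :=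
  (u.ev ⟨lift x.1, proj_lift x.1⟩).symm (g.1 (preMk x.2 ⟨lift x.1, proj_lift x.1⟩))

/-- `glue` reads `g` at one chosen preimage of each point, and `ev_eq_of_ev_eq` shows that every
other preimage gives the same vector. -/
theorem IsMultiplier.ev_glue (hB : u.IsMultiplier B) {U : Opens (Torus τ)} (g : AutoSec τ B U)
    (z : pre U) : u.ev ⟨z, rfl⟩ (u.glue g (preProj z)) = g.1 z :=
  hB.ev_eq_of_ev_eq g (preProj z).2 _ ⟨lift (preProj z).1, proj_lift _⟩ ⟨z, rfl⟩
    (LinearEquiv.apply_symm_apply _ _)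

/-- The sheaf of sections of `E` is the sheaf of equivariant functions. -/
def secIso (u : Unif E ι) (hB : u.IsMultiplier B) :
    OModule.Iso E.sheafOfSections (autoSheaf τ B) where
  toEquiv U :=
    { toFun := fun s : Sec E U => (⟨fun z => u.ev ⟨z, rfl⟩ (s.1 (preProj z)), u.contMDiff_ev s,
        fun z z' h => by
          have hz : proj τ z' = preProj z := by simp only [h, proj_add_one, preProj]
          beta_reduce
          rw [u.ev_preProj s.1 z' hz]
          exact hB.add_one ⟨z, rfl⟩ ⟨z', hz⟩ _ h,
        fun z z' h => by
          have hz : proj τ z' = preProj z := by simp only [h, proj_add_tau, preProj]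
          beta_reduce
          rw [u.ev_preProj s.1 z' hz]
          exact hB.add_tau ⟨z, rfl⟩ ⟨z', hz⟩ _ h⟩ : AutoSec τ B U)
      -- By `ev_glue`, the function describing the glued section is `g`, so the section is
      -- holomorphic although `lift` is not even continuous.
      invFun := fun g : AutoSec τ B U => (⟨u.glue g, u.contMDiff_of_ev _ (by
        simpa only [hB.ev_glue g] using g.2.1)⟩ : Sec E U)
      map_add' := fun _ _ => Subtype.ext (funext fun z => (u.ev ⟨z, rfl⟩).map_add _ _)
      map_smul' := fun _ _ => Subtype.ext (funext fun z => (u.ev ⟨z, rfl⟩).map_smul _ _)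
      left_inv := fun s => Subtype.ext (funext fun x => by
        change (u.ev ⟨lift x.1, proj_lift x.1⟩).symm _ = s.1 x
        rw [LinearEquiv.symm_apply_eq]
        exact u.ev_preProj s.1 (preMk x.2 ⟨lift x.1, proj_lift x.1⟩) (proj_lift x.1))
      right_inv := fun g => Subtype.ext (funext fun z => hB.ev_glue g z) }
  naturality _ _ := rfl

/-- Two bundles with the same multipliers are isomorphic. -/
theorem IsMultiplier.isIsomorphic {u' : Unif E' ι} (hB : u.IsMultiplier B)
    (hB' : u'.IsMultiplier B) : E.IsIsomorphic E' :=
  isIsomorphic_of_iso ((u.secIso hB).trans (u'.secIso hB').symm)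

end Unif

/-! ### Bundles defined by factors of automorphy -/

namespace Automorphy

variable {τ : ℍ} {ι : Type} [Fintype ι] [DecidableEq ι] (f : Automorphy τ ι)

theorem triv_symm (z₀ : ℂ) {x : Torus τ}
    (hx : x ∈ (localInv τ (lift (proj τ z₀))).source) (v : ι → ℂ) :
    (f.bundle.triv (proj τ z₀)).symm x v =
      (f.evalEquiv ⟨localInv τ (lift (proj τ z₀)) x, proj_localInv hx⟩).symm v :=
  f.pretrivialization_symm hx v

theorem triv_apply (z₀ : ℂ) {x : Torus τ}
    (hx : x ∈ (localInv τ (lift (proj τ z₀))).source) (s : f.Fiber x) :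
    (f.bundle.triv (proj τ z₀) ⟨x, s⟩).2 =
      f.evalEquiv ⟨localInv τ (lift (proj τ z₀)) x, proj_localInv hx⟩ s :=
  congrArg Prod.snd (f.pretrivialization_apply hx s)

theorem evalEquiv_symm {x : Torus τ} (z w : {z : ℂ // proj τ z = x}) (v : ι → ℂ) :
    f.evalEquiv w ((f.evalEquiv z).symm v) = (f.toFun (diff z w) z : Matrix ι ι ℂ) *ᵥ v := rfl

/-- The preferred trivialization at `proj τ z₀` uses the local inverse at the chosen preimage of
that point, which may differ from `z₀`. Near `z₀` the discrepancy is one constant lattice vector. -/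
theorem exists_eventually_eq_localInv (z₀ : ℂ) : ∃ γ : lattice τ, ∀ᶠ z in 𝓝 z₀,
    proj τ z ∈ (localInv τ (lift (proj τ z₀))).source ∧
      localInv τ (lift (proj τ z₀)) (proj τ z) = γ + z := by
  have hx := mem_localInv_lift_source (proj τ z₀)
  obtain ⟨γ, hγ⟩ := localInv_sub_eventuallyEq (mem_localInv_source τ z₀) hx
  have hc := (contMDiff_proj τ).continuous.continuousAt (x := z₀)
  refine ⟨γ, ?_⟩
  filter_upwards [hc.eventually hγ, hc.eventually ((localInv τ _).open_source.mem_nhds hx),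
    (localInv τ z₀).open_target.mem_nhds
      (isLocalHomeomorph_proj τ).self_mem_localInverseAt_target] with z h1 h2 h3
  refine ⟨h2, ?_⟩
  have h4 := (localInv τ z₀).right_inv h3
  rw [localInv_symm] at h4
  rw [h1, h4]

theorem contMDiff_mulVec (γ : lattice τ) {g : ℂ → ℂ} (hg : Differentiable ℂ g) (v : ι → ℂ) :
    ContMDiff 𝓘(ℂ, ℂ) 𝓘(ℂ, ι → ℂ) ω fun z => (f.toFun γ (g z) : Matrix ι ι ℂ) *ᵥ v := by
  rw [contMDiff_pi_space]
  intro i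
  have h : Differentiable ℂ fun z => ((f.toFun γ (g z) : Matrix ι ι ℂ) *ᵥ v) i := by
    simp only [mulVec, dotProduct]
    exact Differentiable.fun_sum fun j _ => ((f.differentiable γ i j).comp hg).mul_const _
  exact h.contDiff.contMDiff

/-- The tautological trivialization of the pullback of `E(f)` to `ℂ`. -/
def unif : Unif f.bundle ι where
  ev z := f.evalEquiv z
  hol z₀ v := by
    obtain ⟨γ, hγ⟩ := exists_eventually_eq_localInv (τ := τ) z₀
    -- The constant section `v` takes the value `v` at γ + z, hence f(-γ, γ + z) v at z.
    refine (f.contMDiff_mulVec (-γ) (g := fun z => γ + z) (by fun_prop) v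
      z₀).congr_of_eventuallyEq ?_
    filter_upwards [hγ] with z hz
    have hd : diff (x := proj τ z) ⟨localInv τ (lift (proj τ z₀)) (proj τ z), proj_localInv hz.1⟩
        ⟨z, rfl⟩ = -γ := Subtype.ext (by simp [diff, hz.2])
    refine (congrArg (f.evalEquiv ⟨z, rfl⟩) (f.triv_symm z₀ hz.1 v)).trans ?_
    refine (f.evalEquiv_symm _ _ v).trans ?_
    rw [hd]
    exact congrArg (fun w => (f.toFun (-γ) w : Matrix ι ι ℂ) *ᵥ v) hz.2
  hol_symm z₀ v := by
    obtain ⟨γ, hγ⟩ := exists_eventually_eq_localInv (τ := τ) z₀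
    -- Conversely, a vector with coordinate `v` at z has coordinate f(γ, z) v at γ + z.
    refine (f.contMDiff_mulVec γ (g := fun z => z) (by fun_prop) v z₀).congr_of_eventuallyEq ?_
    filter_upwards [hγ] with z hz
    have hd : diff (x := proj τ z) ⟨z, rfl⟩
        ⟨localInv τ (lift (proj τ z₀)) (proj τ z), proj_localInv hz.1⟩ = γ :=
      Subtype.ext (by simp [diff, hz.2])
    refine (f.triv_apply z₀ hz.1 _).trans ?_
    refine (f.evalEquiv_symm _ _ v).trans ?_
    rw [hd]

end Automorphy

namespace HolGL

variable {ι : Type} [Fintype ι] [DecidableEq ι] (A : HolGL ι)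

/-- The matrix `A(e^{2πiz})`. -/
def mat (z : ℂ) : Matrix ι ι ℂ := (A.toFun (expUnit z)).1

/-- The tautological trivialization of the pullback of `E(A)` to `ℂ`. -/
def unif (τ : ℍ) : Unif (A.bundle τ) ι := (A.automorphy τ).unif

/-- The factor of automorphy is A(m, u) at mτ + k, so the generators 1 and τ give A(0, u) = 1 and
A(1, u) = A(u). -/
theorem isMultiplier (τ : ℍ) : (A.unif τ).IsMultiplier A.mat where
  add_one := by
    intro x z z' s h
    let γ : lattice τ := ⟨1, 0, 1, by simp⟩
    have hγ : tauCoeff γ = 0 := tauCoeff_eq (n := 1) (by simp [γ])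
    have hz : z' = Automorphy.translate γ z := Subtype.ext (by
      rw [h, add_comm]
      rfl)
    subst hz
    refine (s.2 γ z).trans ?_
    change (A.iter (nome τ) (tauCoeff γ) (expUnit z)).1 *ᵥ s.1 z = s.1 z
    rw [hγ, iter_zero]
    simp
  add_tau := by
    intro x z z' s h
    let γ : lattice τ := ⟨τ, 1, 0, by simp⟩
    -- Written `0 + 1` so that `iter_succ` applies.
    have hγ : tauCoeff γ = 0 + 1 := tauCoeff_eq (n := 0) (by simp [γ])
    have hz : z' = Automorphy.translate γ z := Subtype.ext (by
      rw [h, add_comm]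
      rfl)
    subst hz
    refine (s.2 γ z).trans ?_
    change (A.iter (nome τ) (tauCoeff γ) (expUnit z)).1 *ᵥ s.1 z = A.mat z *ᵥ s.1 z
    rw [hγ, iter_succ, iter_zero]
    simp [mat]

end HolGL

/-! ### Operations on trivializations -/

namespace Unif

variable {τ : ℍ} {ι κ : Type} [Fintype ι] [Fintype κ]

/-- Renumbering the coordinates. -/
def reindex {E : HolVectorBundle (Torus τ)} (u : Unif E ι) (e : κ ≃ ι) : Unif E κ where
  ev z := (u.ev z).trans (LinearEquiv.funCongrLeft ℂ ℂ e)
  hol z₀ v := by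
    rw [contMDiffAt_pi_space]
    exact fun i => contMDiffAt_pi_space.mp (u.hol z₀ v) (e i)
  hol_symm z₀ v := u.hol_symm z₀ ((LinearEquiv.funCongrLeft ℂ ℂ e).symm v)

theorem IsMultiplier.reindex {E : HolVectorBundle (Torus τ)} {u : Unif E ι}
    {B : ℂ → Matrix ι ι ℂ} (hB : u.IsMultiplier B) (e : κ ≃ ι) :
    (u.reindex e).IsMultiplier fun z => (B z).submatrix e e where
  add_one z z' w h := congrArg (LinearEquiv.funCongrLeft ℂ ℂ e) (hB.add_one z z' w h)
  add_tau z z' w h := by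
    refine (congrArg (LinearEquiv.funCongrLeft ℂ ℂ e) (hB.add_tau z z' w h)).trans ?_
    rw [submatrix_mulVec_equiv]
    change (B z *ᵥ u.ev z w) ∘ e = (B z *ᵥ ((u.ev z w ∘ e) ∘ e.symm)) ∘ e
    rw [Function.comp_assoc, Equiv.self_comp_symm, Function.comp_id]

/-- The trivialization of the pullback of `E` to `ℂ`, for the pullback of `E` along `π_r`. -/
def pullback {E : HolVectorBundle (Torus τ)} (u : Unif E ι) (r : ℕ) [NeZero r] :
    Unif (E.pullback (cover r τ)) ι where
  -- A preimage z of `x` in ℂ is also a preimage of π_r(x), since p_τ = π_r ∘ p_{rτ}; the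
  -- trivialization on ℂ is unchanged.
  ev {x} z := u.ev (x := cover r τ x) ⟨z, congrArg (coverFun r τ) z.2⟩
  hol z₀ v := by
    refine (u.hol z₀ v).congr_of_eventuallyEq ?_
    filter_upwards [(contMDiff_proj τ).continuous.continuousAt.eventually
      ((E.trivDom (proj τ z₀)).isOpen.mem_nhds (E.mem_trivDom _))] with z hz
    exact congrArg (u.ev ⟨z, rfl⟩) (E.pullback_triv_symm (cover r τ)
      (y₀ := proj (scale r τ) z₀) (y := proj (scale r τ) z) hz v)
  hol_symm z₀ v := u.hol_symm z₀ v

/-- As for pullbacks, the coordinates are componentwise by definition, and the inverse is identified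
by the left inverse law. -/
theorem directSum_triv_symm (E : κ → HolVectorBundle (Torus τ)) {x₀ x : Torus τ}
    (hx : ∀ i, x ∈ (E i).trivDom x₀) (v : ∀ i, (E i).Model) :
    ((HolVectorBundle.directSum E).triv x₀).symm x v =
      fun i => ((E i).triv x₀).symm x (v i) := by
  have h := ((HolVectorBundle.directSum E).triv x₀).symm_apply_apply_mk (b := x)
    (mem_iInter.mpr hx) (fun i => ((E i).triv x₀).symm x (v i))
  have h2 : (((HolVectorBundle.directSum E).triv x₀)
      ⟨x, fun i => ((E i).triv x₀).symm x (v i)⟩).2 = v :=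
    funext fun i => congrArg Prod.snd (((E i).triv x₀).apply_mk_symm (hx i) (v i))
  rwa [h2] at h

/-- The direct sum of trivializations. -/
def directSum {E : κ → HolVectorBundle (Torus τ)} (u : ∀ i, Unif (E i) ι) :
    Unif (HolVectorBundle.directSum E) (κ × ι) where
  ev z := (LinearEquiv.piCongrRight fun i => (u i).ev z).trans
    (LinearEquiv.curry ℂ ℂ κ ι).symm
  hol z₀ v := by
    rw [contMDiffAt_pi_space]
    rintro ⟨i, j⟩
    refine (contMDiffAt_pi_space.mp ((u i).hol z₀ (v i)) j).congr_of_eventuallyEq ?_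
    have hev : ∀ᶠ z in 𝓝 z₀, ∀ i, proj τ z ∈ (E i).trivDom (proj τ z₀) :=
      Filter.eventually_all.mpr fun i => (contMDiff_proj τ).continuous.continuousAt.eventually
        (((E i).trivDom (proj τ z₀)).isOpen.mem_nhds ((E i).mem_trivDom _))
    filter_upwards [hev] with z hz
    exact congrArg (fun w : ∀ i, (E i).Fiber (proj τ z) => (u i).ev ⟨z, rfl⟩ (w i) j)
      (directSum_triv_symm E hz v)
  hol_symm z₀ v := by
    refine contMDiffAt_pi_space.mpr fun i => ?_
    exact (u i).hol_symm z₀ (fun j => v (i, j))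

/-- The entrywise form of the matrix makes it agree definitionally with the matrix of `blockDiag`.
-/
theorem IsMultiplier.directSum {E : κ → HolVectorBundle (Torus τ)} {u : ∀ i, Unif (E i) ι}
    [DecidableEq κ] {B : κ → ℂ → Matrix ι ι ℂ} (hB : ∀ i, (u i).IsMultiplier (B i)) :
    (Unif.directSum u).IsMultiplier fun z => of fun p p' : κ × ι =>
      if p.1 = p'.1 then B p.1 z p.2 p'.2 else 0 where
  add_one z z' w h := funext fun p => congrFun ((hB p.1).add_one z z' (w p.1) h) p.2
  add_tau z z' w h := funext fun p => by
    refine (congrFun ((hB p.1).add_tau z z' (w p.1) h) p.2).trans ?_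
    simp only [mulVec, dotProduct, Fintype.sum_prod_type, of_apply, ite_mul, zero_mul,
      Finset.sum_ite_irrel, Finset.sum_const_zero, Finset.sum_ite_eq, Finset.mem_univ, if_true]
    rfl

end Unif

/-! ### The block companion matrix -/

namespace HolGL

variable {ι : Type} [Fintype ι] [DecidableEq ι] (A : HolGL ι) {r : ℕ} [NeZero r]

theorem companion_mulVec_of_lt (z : ℂ) (v : Fin r × ι → ℂ) (k l : Fin r) (h : (k : ℕ) + 1 = l)
    (i : ι) : ((A.companion r).mat z *ᵥ v) (k, i) = v (l, i) := by
  simp only [mat, companion, mulVec, dotProduct, of_apply, Fintype.sum_prod_type]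
  rw [Finset.sum_eq_single l]
  · simp [h, one_apply]
  · intro m _ hm
    have h1 : (k : ℕ) + 1 ≠ m := fun h' => hm (Fin.ext (by omega))
    have h2 : (k : ℕ) + 1 ≠ r := by have := l.2; omega
    simp [h1, h2]
  · simp

theorem companion_mulVec_last (z : ℂ) (v : Fin r × ι → ℂ) (k : Fin r) (h : (k : ℕ) + 1 = r)
    (i : ι) : ((A.companion r).mat z *ᵥ v) (k, i) = (A.mat z *ᵥ fun j => v (0, j)) i := by
  simp only [mat, companion, mulVec, dotProduct, of_apply, Fintype.sum_prod_type]
  rw [Finset.sum_eq_single 0]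
  · have h0 : r ≠ 0 := NeZero.ne r
    simp [h, h0]
  · intro m _ hm
    have h1 : (k : ℕ) + 1 ≠ m := by have := m.2; omega
    have h2 : (m : ℕ) ≠ 0 := fun h' => hm (Fin.ext (by simpa using h'))
    simp [h1, h2]
  · simp

/-- Each companion step moves block k + 1 to block k, so `m` steps move block k + m to block k. The
bound on `l` ensures that the last row, the one containing A, is not used. -/
theorem companion_iterate {z : ℕ → ℂ} {v : ℕ → Fin r × ι → ℂ}
    (hv : ∀ j, v (j + 1) = (A.companion r).mat (z j) *ᵥ v j) (i : ι) (m : ℕ) :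
    ∀ (j : ℕ) (k l : Fin r), (k : ℕ) + m = l → v (j + m) (k, i) = v j (l, i) := by
  induction m with
  | zero =>
    intro j k l h
    obtain rfl : k = l := Fin.ext h
    rfl
  | succ m ih =>
    intro j k l h
    have hl := l.2
    rw [← add_assoc, hv, A.companion_mulVec_of_lt _ _ k ⟨k + 1, by omega⟩ rfl,
      ih j ⟨k + 1, by omega⟩ l (by simp only; omega)]

/-- The product of `r` companion matrices is block diagonal. -/
theorem companion_iterate_self {z : ℕ → ℂ} {v : ℕ → Fin r × ι → ℂ}
    (hv : ∀ j, v (j + 1) = (A.companion r).mat (z j) *ᵥ v j) (k : Fin r) (i : ι) :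
    v r (k, i) = (A.mat (z k) *ᵥ fun j => v 0 (k, j)) i := by
  have hk := k.2
  -- The r steps split as k + 1 + m. The first k bring block k to block 0, the next applies A at `z
  -- k` and puts the result in block r - 1 = k + m, and the remaining m bring it back to block k.
  obtain ⟨m, hm⟩ : ∃ m, r = k + 1 + m := ⟨r - (k + 1), by omega⟩
  have h1 := A.companion_iterate hv i m (k + 1) k ⟨k + m, by omega⟩ rfl
  rw [← hm] at h1
  rw [h1, hv, A.companion_mulVec_last _ _ _ (by simp only; omega)]
  have h2 : ∀ j, v k (0, j) = v 0 (k, j) := fun j => by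
    simpa using A.companion_iterate hv j k 0 0 k (by simp)
  simp only [h2]

end HolGL

/-! ### The multiplier of the pulled-back companion bundle -/

theorem expUnit_add_mul (τ : ℍ) (z : ℂ) (k : ℕ) :
    expUnit (z + k * τ) = nome τ ^ k * expUnit z := by
  have h := expUnit_intCast_mul (k : ℤ) (τ : ℂ)
  rw [Int.cast_natCast, zpow_natCast] at h
  rw [expUnit_add, h, mul_comm, nome]

theorem coe_scale (r : ℕ) [NeZero r] (τ : ℍ) : ((scale r τ : ℍ) : ℂ) = r * τ := rfl

theorem proj_add_mul (τ : ℍ) (z : ℂ) (k : ℕ) : proj τ (z + k * τ) = proj τ z :=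
  (proj_eq_iff.mpr ⟨k, 0, by simp⟩).symm

namespace HolGL

variable {ι : Type} [Fintype ι] [DecidableEq ι] (A : HolGL ι) (r : ℕ)

theorem blockDiag_mat (B : Fin r → HolGL ι) (z : ℂ) :
    (blockDiag B).mat z = of fun p p' : Fin r × ι =>
      if p.1 = p'.1 then (B p.1).mat z p.2 p'.2 else 0 := rfl

/-- The stated diagonal starts with A(q^{r-1}u), whereas the product of companion matrices starts
with A(u); reversing the blocks reconciles the two. -/
theorem isMultiplier_reindex_blockDiag (τ σ : ℍ) :
    (((blockDiag fun i : Fin r => A.shift (nome τ ^ (r - 1 - (i : ℕ)))).unif σ).reindex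
      ((Fin.revPerm (n := r)).prodCongr (Equiv.refl ι))).IsMultiplier
      (blockDiag fun k : Fin r => A.shift (nome τ ^ (k : ℕ))).mat := by
  convert ((blockDiag fun i : Fin r =>
    A.shift (nome τ ^ (r - 1 - (i : ℕ)))).isMultiplier σ).reindex _ using 1
  funext z
  ext ⟨k, i⟩ ⟨l, j⟩
  -- `Fin.revPerm` sends k to r - (k + 1).
  have h : r - 1 - (r - (k + 1)) = (k : ℕ) := by have := k.2; omega
  simp [blockDiag_mat, h]

theorem shift_mat (τ : ℍ) (k : ℕ) (z : ℂ) : (A.shift (nome τ ^ k)).mat z = A.mat (z + k * τ) := by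
  rw [mat, mat, expUnit_add_mul]
  rfl

variable [NeZero r]

/-- The multiplier of the pullback of the bundle defined by the companion matrix. -/
theorem isMultiplier_pullback_companion (τ : ℍ) :
    (((A.companion r).unif τ).pullback r).IsMultiplier
      (blockDiag fun k : Fin r => A.shift (nome τ ^ (k : ℕ))).mat where
  add_one {x} z z' w h := ((A.companion r).isMultiplier τ).add_one (x := cover r τ x)
    ⟨z, congrArg (coverFun r τ) z.2⟩ ⟨z', congrArg (coverFun r τ) z'.2⟩ w h
  add_tau {x} z z' w h := by
    let y := cover r τ x
    have hz : proj τ z = y := congrArg (coverFun r τ) z.2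
    -- Translation by rτ is taken in r steps of τ; all the points z + jτ lie over the same point of
    -- E_τ, so each step is governed by the companion matrix.
    let p : ℕ → {z : ℂ // proj τ z = y} := fun j => ⟨z + j * τ, (proj_add_mul τ z j).trans hz⟩
    have hv : ∀ j, ((A.companion r).unif τ).ev (p (j + 1)) w =
        (A.companion r).mat (p j) *ᵥ ((A.companion r).unif τ).ev (p j) w := fun j =>
      ((A.companion r).isMultiplier τ).add_tau (p j) (p (j + 1)) w (by
        simp only [p]
        push_cast
        ring)
    have key := A.companion_iterate_self (z := fun j => p j)
      (v := fun j => ((A.companion r).unif τ).ev (p j) w) hv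
    have e0 : (⟨z, hz⟩ : {z : ℂ // proj τ z = y}) = p 0 := Subtype.ext (by simp [p])
    have er : (⟨z', congrArg (coverFun r τ) z'.2⟩ : {z : ℂ // proj τ z = y}) = p r :=
      Subtype.ext (by simp [p, h, coe_scale])
    change ((A.companion r).unif τ).ev ⟨z', _⟩ w = _ *ᵥ ((A.companion r).unif τ).ev ⟨z, hz⟩ w
    rw [er, e0]
    funext ⟨k, i⟩
    rw [key k i, blockDiag_mat]
    simp only [mulVec, dotProduct, Fintype.sum_prod_type, of_apply, ite_mul, zero_mul,
      Finset.sum_ite_irrel, Finset.sum_const_zero, Finset.sum_ite_eq, Finset.mem_univ, if_true,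
      shift_mat]
    rfl

end HolGL

/-! ### Direct images -/

section DirectImage

variable {τ : ℍ} {ι : Type} [Fintype ι] [DecidableEq ι] (A : HolGL ι) (r : ℕ) [NeZero r]

/-- Translation by `kτ` on `p_τ⁻¹(U)`. -/
def shiftPre {U : Opens (Torus τ)} (k : ℕ) (z : pre U) : pre U :=
  ⟨z + k * τ, show proj τ (z + k * τ) ∈ U from (proj_add_mul τ z k).symm ▸ z.2⟩

theorem contMDiff_shiftPre (U : Opens (Torus τ)) (k : ℕ) :
    ContMDiff 𝓘(ℂ, ℂ) 𝓘(ℂ, ℂ) ω (shiftPre k : pre U → pre U) := by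
  intro z
  refine (ChartedSpace.liftPropWithinAt_subtypeVal_comp_iff _ _ _).mp ?_
  have h : ContMDiff 𝓘(ℂ, ℂ) 𝓘(ℂ, ℂ) ω fun z : ℂ => z + k * τ :=
    contMDiff_id.add contMDiff_const
  exact (h.comp contMDiff_subtype_val) z

theorem preProj_shiftPre {U : Opens (Torus τ)} (k : ℕ) (z : pre U) :
    preProj (shiftPre k z) = preProj z :=
  Subtype.ext (proj_add_mul τ z k)

/-- The open set `π_r⁻¹(U)`. -/
abbrev coverPre (U : Opens (Torus τ)) : Opens (Torus (scale r τ)) :=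
  U.comap (cover r τ : C(Torus (scale r τ), Torus τ))

/-- An equivariant function `g` for `rτ` gives the function with components
`z ↦ g(z + kτ)` for `τ`. -/
def toCompanion {U : Opens (Torus τ)} (g : AutoSec (scale r τ) A.mat (coverPre r U)) :
    AutoSec τ (A.companion r).mat U :=
  -- The preimage in ℂ of `coverPre r U` is that of `U`, by definition, so `g` may be evaluated at
  -- points of `pre U`.
  ⟨fun z p => g.1 (shiftPre (U := U) p.1 z) p.2, by
    refine contMDiff_pi_space.mpr fun p => ?_
    exact (contMDiff_pi_space.mp g.2.1 p.2).comp (contMDiff_shiftPre U p.1), by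
    intro z z' h
    funext p
    refine congrFun (g.2.2.1 (shiftPre (U := U) p.1 z) (shiftPre (U := U) p.1 z') ?_) p.2
    simp only [shiftPre, h]
    ring, by
    rintro z z' h
    funext ⟨k, i⟩
    by_cases hk : (k : ℕ) + 1 < r
    · rw [A.companion_mulVec_of_lt _ _ k ⟨k + 1, hk⟩ rfl]
      have hz : shiftPre (U := U) k z' = shiftPre (k + 1) z := Subtype.ext (by
        simp only [shiftPre, h]
        push_cast
        ring)
      exact congrArg (fun y : pre U => g.1 y i) hz
    -- In the last block the translate is z + rτ, where the equivariance of `g` for rτ enters.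
    · have hk' : (k : ℕ) + 1 = r := by have := k.2; omega
      rw [A.companion_mulVec_last _ _ k hk']
      have h0 : shiftPre (U := U) ((0 : Fin r) : ℕ) z = z := Subtype.ext (by simp [shiftPre])
      refine (congrFun (g.2.2.2 (shiftPre (U := U) ((0 : Fin r) : ℕ) z)
        (shiftPre (U := U) k z') ?_) i).trans ?_
      · rw [h0, coe_scale]
        have hr : (r : ℂ) = k + 1 := by exact_mod_cast hk'.symm
        change (z' : ℂ) + k * τ = z + r * τ
        rw [h, hr]
        ring
      · rw [h0]
        refine congrArg (fun y => (A.mat z *ᵥ y) i) (funext fun j => ?_)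
        exact congrArg (fun y : pre U => g.1 y j) h0.symm⟩

theorem apply_shiftPre {U : Opens (Torus τ)} (G : AutoSec τ (A.companion r).mat U) (z : pre U)
    (j : ℕ) : G.1 (shiftPre (j + 1) z) = (A.companion r).mat (shiftPre j z) *ᵥ G.1 (shiftPre j z) :=
  G.2.2.2 (shiftPre j z) (shiftPre (j + 1) z) (by
    simp only [shiftPre]
    push_cast
    ring)

theorem shiftPre_zero {U : Opens (Torus τ)} (z : pre U) : shiftPre 0 z = z :=
  Subtype.ext (by simp [shiftPre])

/-- The first components of an equivariant function for the companion matrix. -/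
def ofCompanion {U : Opens (Torus τ)} (G : AutoSec τ (A.companion r).mat U) :
    AutoSec (scale r τ) A.mat (coverPre r U) :=
  ⟨fun (z : pre U) i => G.1 z (0, i),
    contMDiff_pi_space.mpr fun i => contMDiff_pi_space.mp G.2.1 (0, i),
    fun z z' h => funext fun i => congrFun (G.2.2.1 z z' h) (0, i), by
    intro (z : pre U) (z' : pre U) h
    have hz : z' = shiftPre r z := Subtype.ext h
    -- Block 0 of the product of r companion matrices is A at z itself.
    have key := A.companion_iterate_self (z := fun j => (shiftPre j z : ℂ))
      (v := fun j => G.1 (shiftPre j z)) (apply_shiftPre A r G z) 0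
    subst hz
    funext i
    have h0 : shiftPre ((0 : Fin r) : ℕ) z = z := shiftPre_zero z
    simpa only [shiftPre_zero, h0] using key i⟩

/-- The direct image of a sheaf of equivariant functions. -/
def autoSheafDirectImage (τ : ℍ) :
    OModule.Iso ((autoSheaf (scale r τ) A.mat).directImage (cover r τ))
      (autoSheaf τ (A.companion r).mat) where
  toEquiv U :=
    { toFun := toCompanion A r (U := U)
      invFun := ofCompanion A r (U := U)
      map_add' := fun _ _ => rfl
      map_smul' := fun f g => by
        refine Subtype.ext (funext fun z => funext fun p => ?_)
        -- A function on `U` takes the same value at all translates z + kτ, so it multiplies every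
        -- block by the same scalar.
        exact congrArg (fun x : U => f x • g.1 (shiftPre (U := U) p.1 z) p.2)
          (preProj_shiftPre p.1 z)
      left_inv := fun g => by
        refine Subtype.ext (funext fun z => funext fun i => ?_)
        exact congrArg (fun y : pre U => g.1 y i) (shiftPre_zero (U := U) z)
      right_inv := fun G => by
        refine Subtype.ext (funext fun z => funext fun ⟨k, i⟩ => ?_)
        -- Block k of G(z) is block 0 of G(z + kτ), so the first block determines `G`.
        have := A.companion_iterate (z := fun j => (shiftPre j z : ℂ))
          (v := fun j => G.1 (shiftPre j z)) (apply_shiftPre A r G z) i k 0 0 k (by simp)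
        rw [shiftPre_zero, zero_add] at this
        exact this }
  naturality _ _ := rfl

/-- The bundle defined by the companion matrix is a direct image. -/
def companionDirectImage (τ : ℍ) {F : HolVectorBundle (Torus (scale r τ))}
    (T : HolVectorBundle.Iso F (A.bundle (scale r τ))) :
    OModule.Iso (F.sheafOfSections.directImage (cover r τ))
      ((A.companion r).bundle τ).sheafOfSections :=
  ((T.secIso.trans ((A.unif _).secIso (A.isMultiplier _))).directImage (cover r τ)).trans
    ((autoSheafDirectImage A r τ).trans
      (((A.companion r).unif τ).secIso ((A.companion r).isMultiplier τ)).symm)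

/-- A direct image of a bundle defined by `A` is isomorphic to the bundle defined by the companion
matrix. -/
theorem isIsomorphic_companion {F : HolVectorBundle (Torus (scale r τ))}
    (hF : F.IsIsomorphic (A.bundle (scale r τ))) {G : HolVectorBundle (Torus τ)}
    (hG : IsDirectImage (cover r τ) F G) : G.IsIsomorphic ((A.companion r).bundle τ) := by
  obtain ⟨T⟩ := hF
  obtain ⟨φ⟩ := hG
  exact isIsomorphic_of_iso (φ.symm.trans (companionDirectImage A r τ T))

end DirectImage

/-! ### Conclusion -/

theorem HolVectorBundle.IsIsomorphic.refl {X : Type} [TopologicalSpace X]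
    [ChartedSpace ℂ X] (E : HolVectorBundle X) : E.IsIsomorphic E :=
  ⟨⟨fun _ => LinearEquiv.refl ℂ _, contMDiff_id, contMDiff_id⟩⟩

theorem HolVectorBundle.IsIsomorphic.trans {X : Type} [TopologicalSpace X]
    [ChartedSpace ℂ X] {E F G : HolVectorBundle X} (h : E.IsIsomorphic F)
    (h' : F.IsIsomorphic G) : E.IsIsomorphic G := by
  obtain ⟨T⟩ := h
  obtain ⟨T'⟩ := h'
  exact isIsomorphic_of_iso (T.secIso.trans T'.secIso)

end

end EllVB

theorem mainTheorem10 (τ : UpperHalfPlane) (r : ℕ) [NeZero r] (n : ℕ) (A : HolGL (Fin n)) :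
    (∀ F : HolVectorBundle (Torus (scale r τ)), F.IsIsomorphic (A.bundle (scale r τ)) →
      HolVectorBundle.IsDirectImage (cover r τ) F ((A.companion r).bundle τ) ∧
      ∀ G : HolVectorBundle (Torus τ), HolVectorBundle.IsDirectImage (cover r τ) F G →
        G.IsIsomorphic ((A.companion r).bundle τ)) ∧
    (∀ G : HolVectorBundle (Torus τ),
      HolVectorBundle.IsDirectImage (cover r τ) (A.bundle (scale r τ)) G →
      (G.pullback (cover r τ)).IsIsomorphic
        ((HolGL.blockDiag fun i : Fin r => A.shift (nome τ ^ (r - 1 - (i : ℕ)))).bundle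
          (scale r τ)) ∧
      (G.pullback (cover r τ)).IsIsomorphic
        (HolVectorBundle.directSum fun i : Fin r =>
          (A.shift (nome τ ^ (i : ℕ))).bundle (scale r τ))) := by
  refine ⟨fun F hF => ⟨hF.elim fun T => ⟨companionDirectImage A r τ T⟩,
    fun G hG => isIsomorphic_companion A r hF hG⟩, fun G hG => ?_⟩
  -- By (1) the direct image is the companion bundle, so only the pullback of the latter has to be
  -- identified.
  have hG' := (isIsomorphic_companion A r (HolVectorBundle.IsIsomorphic.refl _) hG).pullback
    (cover r τ)
  have hC := A.isMultiplier_pullback_companion r τ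
  -- Both targets share the multiplier in `hC`: the first after its blocks are reversed, the second
  -- as it stands.
  exact ⟨hG'.trans (hC.isIsomorphic (A.isMultiplier_reindex_blockDiag r τ (scale r τ))),
    hG'.trans (hC.isIsomorphic (Unif.IsMultiplier.directSum fun i : Fin r =>
      (A.shift (nome τ ^ (i : ℕ))).isMultiplier (scale r τ)))⟩
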